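/- Let $p$ be a prime, $k\ge 0$, and let $S^1$ denote the center of $U(p^k)$. Let $\Gamma_k\subset U(p^k)$ be the irreducible projective elementary abelian $p$-subgroup (unique up to conjugacy), i.e. a subgroup that contains $S^1$, acts irreducibly on $\mathbb{C}^{p^k}$, and is an extension $1\to S^1\to\Gamma_k\to(\mathbb{Z}/p)^{2k}\to 1$. Lifting to $\Gamma_k$ and taking commutators defines a symplectic form on $(\mathbb{Z}/p)^{2k}$ (with values in the $p$-th roots of unity in $S^1$); a subgroup of $\Gamma_k$ is called coisotropic if it is the inverse image of a subspace $W\subseteq(\mathbb{Z}/p)^{2k}$ with $W^\perp\subseteq W$. The symplectic Tits building $\mathrm{T}^{\mathrm{Sp}}_k$ is the (discrete) poset, under inclusion, of proper coisotropic subgroups of $\Gamma_k$. Let $\mathcal{L}_n$ be the topological poset of proper orthogonal decompositions of $\mathbb{C}^n$: its objects are the unordered collections of nontrivial, proper, pairwise orthogonal linear subspaces of $\mathbb{C}^n$ (the components of the decomposition) whose sum is $\mathbb{C}^n$; $\lambda\le\mu$ if $\mu$ is a coarsening of $\lambda$; and the sets of objects and of morphisms $\lambda\le\mu$ are topologized as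 disjoint unions of $U(n)$-orbits. **Theorem.** For every decomposition $\lambda$ in $(\mathcal{L}_{p^k})^{\Gamma_k}$ all components $v$ of $\lambda$ have the same isotropy group $I_\lambda=\{h\in\Gamma_k : hv=v\}$, and this is a proper coisotropic subgroup of $\Gamma_k$. The map $\lambda\mapsto I_\lambda$ is an isomorphism of topological posets $$(\mathcal{L}_{p^k})^{\Gamma_k}\;\cong\;\mathrm{T}^{\mathrm{Sp}}_k ,$$ with inverse sending $H$ to the decomposition of $\mathbb{C}^{p^k}$ into its $H$-isotypical summands. That is, it is an isomorphism of posets and a homeomorphism on the spaces of objects and of morphisms. It therefore induces a homeomorphism in each degree of the topological nerves, and a homeomorphism of their geometric realizations; moreover the fixed point space of $\Gamma_k$ acting on the geometric realization of the nerve of $\mathcal{L}_{p^k}$ is homeomorphic to the geometric realization of $\mathrm{T}^{\mathrm{Sp}}_k$, by the homeomorphism whose inverse is induced by $H\mapsto\{H\text{-isotypical summands}\}$. -/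

import Mathlib

open scoped MonoidAlgebra

/-! ### Topologized posets, their nerves and geometric realizations -/

/-- The morphisms of a poset regarded as a category: pairs `(a, b)` with `a ≤ b`. -/
def Mor (P : Type*) [PartialOrder P] : Type _ := {x : P × P // x.1 ≤ x.2}

/-- The map induced on morphisms by a monotone map. -/
def Mor.map {P Q : Type*} [PartialOrder P] [PartialOrder Q] (f : P →o Q) : Mor P → Mor Q :=
  fun x => ⟨(f x.1.1, f x.1.2), f.monotone x.2⟩

/-- A poset with a topology on its set of objects and a topology on its set of morphisms. -/
class TopologizedPoset (P : Type*) [PartialOrder P] extends TopologicalSpace P where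
  morTopology : TopologicalSpace (Mor P)

instance {P : Type*} [PartialOrder P] [TopologizedPoset P] : TopologicalSpace (Mor P) :=
  TopologizedPoset.morTopology

/-- The `m`-simplices of the nerve of `P`: chains `a₀ ≤ a₁ ≤ ⋯ ≤ a_m`. -/
def Nerve (P : Type*) [PartialOrder P] (m : ℕ) : Type _ := Fin (m + 1) →o P

namespace Nerve

variable {P Q : Type*} [PartialOrder P] [PartialOrder Q]

/-- The `i`-th vertex of a chain. -/
def vertex {m : ℕ} (i : Fin (m + 1)) (σ : Nerve P m) : P := OrderHom.toFun σ i

/-- The morphism `a_i ≤ a_{i+1}` of a chain. -/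
def edge {m : ℕ} (i : Fin m) (σ : Nerve P m) : Mor P :=
  ⟨(σ.vertex i.castSucc, σ.vertex i.succ), OrderHom.monotone σ (Fin.castSucc_lt_succ).le⟩

/-- The simplicial structure: precomposition with a monotone map `[m] → [l]`. -/
def pull {m l : ℕ} (θ : Fin (m + 1) →o Fin (l + 1)) (σ : Nerve P l) : Nerve P m :=
  OrderHom.comp σ θ

/-- The map induced on nerves by a monotone map. -/
def map (f : P →o Q) (m : ℕ) (σ : Nerve P m) : Nerve Q m := OrderHom.comp f σ

/-- The topological nerve: the space of `0`-simplices is the space of objects, and for `1 ≤ m` the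
space of `m`-simplices is the iterated fibre product `Mor ×_Ob Mor ×_Ob ⋯ ×_Ob Mor`.
(For the second case the vertices add nothing as soon as source and target are continuous.) -/
instance [TopologizedPoset P] (m : ℕ) : TopologicalSpace (Nerve P m) :=
  (⨅ i : Fin (m + 1), TopologicalSpace.induced (vertex i) inferInstance) ⊓
    ⨅ i : Fin m, TopologicalSpace.induced (edge i) inferInstance

end Nerve

/-- Gluing relation of the geometric realization: `(θ^* σ, t) ∼ (σ, θ_* t)`. -/
inductive Realization.Rel (P : Type*) [PartialOrder P] :
    (Σ m : ℕ, Nerve P m × stdSimplex ℝ (Fin (m + 1))) →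
    (Σ m : ℕ, Nerve P m × stdSimplex ℝ (Fin (m + 1))) → Prop
  | glue {m l : ℕ} (θ : Fin (m + 1) →o Fin (l + 1)) (σ : Nerve P l)
      (t : stdSimplex ℝ (Fin (m + 1))) :
      Realization.Rel P ⟨m, σ.pull θ, t⟩ ⟨l, σ, stdSimplex.map θ t⟩

/-- The geometric realization of the topological nerve of `P`. -/
def Realization (P : Type*) [PartialOrder P] : Type _ := Quot (Realization.Rel P)

/-- The quotient topology of the disjoint union of the spaces `N_m P × Δ^m`. -/
instance {P : Type*} [PartialOrder P] [TopologizedPoset P] : TopologicalSpace (Realization P) :=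
  inferInstanceAs (TopologicalSpace (Quot (Realization.Rel P)))

/-- The map induced on geometric realizations by a monotone map. -/
def Realization.map {P Q : Type*} [PartialOrder P] [PartialOrder Q] (f : P →o Q) :
    Realization P → Realization Q :=
  Quot.map (fun x => ⟨x.1, x.2.1.map f x.1, x.2.2⟩) (by
    rintro _ _ ⟨θ, σ, t⟩
    exact Realization.Rel.glue θ (σ.map f _) t)

/-! ### Orthogonal decompositions of `ℂⁿ` -/

/-- The unitary group `U(n)`. -/
abbrev U (n : ℕ) : Type := Matrix.unitaryGroup (Fin n) ℂ

/-- The standard representation of `U(n)` on `ℂⁿ`. -/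
noncomputable def stdRep (n : ℕ) : Representation ℂ (U n) (EuclideanSpace ℂ (Fin n)) where
  toFun g := Matrix.toEuclideanLin (g : Matrix (Fin n) (Fin n) ℂ)
  map_one' := by ext v i; simp
  map_mul' g h := by ext v i; simp [Matrix.toLpLin_apply]

theorem stdRep_inner {n : ℕ} (g : U n) (v w : EuclideanSpace ℂ (Fin n)) :
    inner ℂ (stdRep n g v) (stdRep n g w) = inner ℂ v w := by
  have h : Matrix.toEuclideanLin (star (g : Matrix (Fin n) (Fin n) ℂ)) ∘ₗ stdRep n g = 1 := by
    have : star (g : Matrix (Fin n) (Fin n) ℂ) * g = 1 := Unitary.coe_star_mul_self g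
    ext v i
    simp [stdRep, Matrix.toLpLin_apply, Matrix.mulVec_mulVec, this]
  rw [← LinearMap.adjoint_inner_right, stdRep]
  change inner ℂ v ((Matrix.toEuclideanLin (g : Matrix (Fin n) (Fin n) ℂ)).adjoint _) = _
  rw [← Matrix.toEuclideanLin_conjTranspose_eq_adjoint]
  exact congrArg (inner ℂ v) (LinearMap.congr_fun h w)

/-- `U(n)` acts on the linear subspaces of `ℂⁿ`. -/
noncomputable instance (n : ℕ) : MulAction (U n) (Submodule ℂ (EuclideanSpace ℂ (Fin n))) where
  smul g v := v.map (stdRep n g)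
  one_smul v := by
    change v.map (stdRep n 1) = v
    rw [map_one]; exact Submodule.map_id v
  mul_smul g h v := by
    change v.map (stdRep n (g * h)) = (v.map (stdRep n h)).map (stdRep n g)
    rw [map_mul]; exact Submodule.map_comp _ _ _

theorem smul_submodule_def {n : ℕ} (g : U n) (v : Submodule ℂ (EuclideanSpace ℂ (Fin n))) :
    g • v = v.map (stdRep n g) := rfl

/-- A proper orthogonal decomposition of `ℂⁿ`: an unordered collection of nontrivial, pairwise
orthogonal, proper subspaces whose sum is `ℂⁿ`. -/
@[ext] structure OrthDecomp (n : ℕ) where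
  classes : Set (Submodule ℂ (EuclideanSpace ℂ (Fin n)))
  ne_bot : ∀ v ∈ classes, v ≠ ⊥
  ne_top : ∀ v ∈ classes, v ≠ ⊤
  orthogonal : ∀ v ∈ classes, ∀ w ∈ classes, v ≠ w → v ⟂ w
  sSup_eq_top : sSup classes = ⊤

namespace OrthDecomp

variable {n : ℕ}

/-- `a ≤ b` if `b` is a coarsening of `a`. -/
instance : PartialOrder (OrthDecomp n) where
  le a b := ∀ v ∈ a.classes, ∃ w ∈ b.classes, v ≤ w
  le_refl a v hv := ⟨v, hv, le_rfl⟩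
  le_trans a b c hab hbc v hv := by
    obtain ⟨w, hw, hvw⟩ := hab v hv
    obtain ⟨x, hx, hwx⟩ := hbc w hw
    exact ⟨x, hx, hvw.trans hwx⟩
  le_antisymm := by
    have key : ∀ a b : OrthDecomp n, (∀ v ∈ a.classes, ∃ w ∈ b.classes, v ≤ w) →
        (∀ v ∈ b.classes, ∃ w ∈ a.classes, v ≤ w) → a.classes ⊆ b.classes := by
      intro a b hab hba v hv
      obtain ⟨w, hw, hvw⟩ := hab v hv
      obtain ⟨x, hx, hwx⟩ := hba w hw
      have hvx : v = x := by
        by_contra hne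
        exact a.ne_bot v hv (Submodule.isOrtho_self.mp
          ((a.orthogonal v hv x hx hne).mono_right (hvw.trans hwx)))
      have : v = w := le_antisymm hvw (hvx ▸ hwx)
      exact this ▸ hw
    intro a b hab hba
    exact OrthDecomp.ext (Set.Subset.antisymm (key a b hab hba) (key b a hba hab))

/-- The translate of a decomposition by a unitary matrix. -/
noncomputable def translate (g : U n) (a : OrthDecomp n) : OrthDecomp n where
  classes := (fun v => g • v) '' a.classes
  ne_bot := by
    rintro _ ⟨v, hv, rfl⟩ h
    refine a.ne_bot v hv ?_
    have : g⁻¹ • (g • v) = g⁻¹ • ⊥ := congrArg _ h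
    rw [inv_smul_smul] at this
    rw [this, smul_submodule_def, Submodule.map_bot]
  ne_top := by
    rintro _ ⟨v, hv, rfl⟩ h
    refine a.ne_top v hv ?_
    have h2 : g • (⊤ : Submodule ℂ (EuclideanSpace ℂ (Fin n))) = ⊤ :=
      top_le_iff.mp (h.symm.le.trans (Submodule.map_mono le_top))
    exact (MulAction.injective g) (h.trans h2.symm)
  orthogonal := by
    rintro _ ⟨v, hv, rfl⟩ _ ⟨w, hw, rfl⟩ hne
    have hvw := a.orthogonal v hv w hw (fun h => hne (by rw [h]))
    rw [Submodule.isOrtho_iff_inner_eq] at hvw ⊢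
    rintro _ ⟨x, hx, rfl⟩ _ ⟨y, hy, rfl⟩
    rw [stdRep_inner]
    exact hvw x hx y hy
  sSup_eq_top := by
    have h1 : sSup ((fun v => g • v) '' a.classes) = g • sSup a.classes := by
      rw [sSup_image, smul_submodule_def, sSup_eq_iSup]
      simp only [Submodule.map_iSup]
      rfl
    rw [h1, a.sSup_eq_top]
    refine top_le_iff.mp ?_
    calc (⊤ : Submodule ℂ (EuclideanSpace ℂ (Fin n))) = g • (g⁻¹ • ⊤) := (smul_inv_smul g _).symm
      _ ≤ g • ⊤ := Submodule.map_mono le_top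

/-- `U(n)` acts on the set of proper orthogonal decompositions of `ℂⁿ`. -/
noncomputable instance : MulAction (U n) (OrthDecomp n) where
  smul := translate
  one_smul a := OrthDecomp.ext (by
    change (fun v => (1 : U n) • v) '' a.classes = a.classes
    simp)
  mul_smul g h a := OrthDecomp.ext (by
    change (fun v => (g * h) • v) '' a.classes = (fun v => g • v) '' ((fun v => h • v) '' a.classes)
    simp only [Set.image_image, mul_smul])

/-- The action of a unitary matrix as a map of posets. -/
noncomputable def actHom (g : U n) : OrthDecomp n →o OrthDecomp n where
  toFun a := g • a
  monotone' a b hab := by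
    rintro _ ⟨v, hv, rfl⟩
    obtain ⟨w, hw, hvw⟩ := hab v hv
    exact ⟨g • w, ⟨w, hw, rfl⟩, Submodule.map_mono hvw⟩

end OrthDecomp

/-- `U(n)` acts on the morphisms of the poset of decompositions. -/
noncomputable instance (n : ℕ) : MulAction (U n) (Mor (OrthDecomp n)) where
  smul g x := Mor.map (OrthDecomp.actHom g) x
  one_smul x := Subtype.ext (Prod.ext (one_smul _ x.1.1) (one_smul _ x.1.2))
  mul_smul g h x := Subtype.ext (Prod.ext (mul_smul g h x.1.1) (mul_smul g h x.1.2))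

/-- The topology on a `G`-set `X` that makes `X` the disjoint union of its orbits, each orbit
`G • x` carrying the quotient topology under `G → G • x`. -/
@[reducible] def orbitTopology (G X : Type*) [TopologicalSpace G] [Monoid G] [MulAction G X] :
    TopologicalSpace X :=
  ⨆ x : X, TopologicalSpace.coinduced (fun g : G => g • x) inferInstance

/-- The topological poset `𝓛ₙ` of proper orthogonal decompositions of `ℂⁿ`: objects and
morphisms are topologized as disjoint unions of `U(n)`-orbits. -/
noncomputable instance (n : ℕ) : TopologizedPoset (OrthDecomp n) where
  toTopologicalSpace := orbitTopology (U n) (OrthDecomp n)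
  morTopology := orbitTopology (U n) (Mor (OrthDecomp n))

/-! ### Fixed points -/

/-- The poset of decompositions fixed by a subgroup `Γ` of `U(n)`. -/
def FixedDecomp {n : ℕ} (Γ : Subgroup (U n)) : Type := {a : OrthDecomp n // ∀ g ∈ Γ, g • a = a}

namespace FixedDecomp

variable {n : ℕ} (Γ : Subgroup (U n))

instance : PartialOrder (FixedDecomp Γ) :=
  inferInstanceAs (PartialOrder {a : OrthDecomp n // ∀ g ∈ Γ, g • a = a})

/-- The inclusion of the fixed decompositions into all decompositions. -/
def incl : FixedDecomp Γ →o OrthDecomp n where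
  toFun a := a.1
  monotone' _ _ h := h

/-- Objects and morphisms of the fixed poset carry the subspace topologies. -/
noncomputable instance : TopologizedPoset (FixedDecomp Γ) where
  toTopologicalSpace := TopologicalSpace.induced (incl Γ) inferInstance
  morTopology := TopologicalSpace.induced (Mor.map (incl Γ)) inferInstance

end FixedDecomp

/-- The fixed points of `Γ` acting on the geometric realization of `𝓛ₙ`. -/
def realizationFixedPoints {n : ℕ} (Γ : Subgroup (U n)) : Set (Realization (OrthDecomp n)) :=
  {x | ∀ g ∈ Γ, Realization.map (OrthDecomp.actHom g) x = x}

/-- The `Γ`-isotropy group `{h ∈ Γ | h v = v}` of a subspace `v`. -/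
noncomputable def isotropy {n : ℕ} (Γ : Subgroup (U n))
    (v : Submodule ℂ (EuclideanSpace ℂ (Fin n))) : Subgroup Γ :=
  (MulAction.stabilizer (U n) v).subgroupOf Γ

/-- The isotypical summands of `ℂⁿ` under a subgroup `H` of `Γ ≤ U(n)`. -/
noncomputable def isotypicalSummands {n : ℕ} {Γ : Subgroup (U n)} (H : Subgroup Γ) :
    Set (Submodule ℂ (EuclideanSpace ℂ (Fin n))) :=
  let ρ : Representation ℂ H (EuclideanSpace ℂ (Fin n)) :=
    (stdRep n).comp (Γ.subtype.comp H.subtype)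
  (fun V => (V.restrictScalars ℂ).map (ρ.asModuleEquiv : ρ.asModule →ₗ[ℂ] _)) ''
    isotypicComponents ℂ[H] ρ.asModule

/-! ### The group `Γ_k` and the symplectic Tits building -/

/-- The center `S¹` of `U(n)`, as a subgroup of `Γ`. -/
abbrev circleIn {n : ℕ} (Γ : Subgroup (U n)) : Subgroup Γ := (Subgroup.center (U n)).subgroupOf Γ

/-- `Γ ≤ U(p^k)` is (a conjugate of) `Γ_k`: it acts irreducibly on `ℂ^{p^k}` and is an extension
of `(ℤ/p)^{2k}` by the center `S¹` of `U(p^k)`. -/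
structure IsGammaSubgroup (p k : ℕ) (Γ : Subgroup (U (p ^ k))) : Prop where
  center_le : Subgroup.center (U (p ^ k)) ≤ Γ
  quotient : Nonempty (Γ ⧸ circleIn Γ ≃* Multiplicative (Fin (2 * k) → ZMod p))
  irreducible : Representation.IsIrreducible
    ((stdRep (p ^ k)).comp Γ.subtype : Representation ℂ Γ (EuclideanSpace ℂ (Fin (p ^ k))))

/-- The form on `Γ / S¹` given by lifting to `Γ` and taking the commutator. -/
def commForm {n : ℕ} (Γ : Subgroup (U n)) (x y : Γ ⧸ circleIn Γ) : Γ :=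
  Quotient.liftOn₂' x y (fun g h => g * h * g⁻¹ * h⁻¹) (by
    intro g h g' h' hg hh
    rw [QuotientGroup.leftRel_apply] at hg hh
    obtain ⟨z, hz, rfl⟩ : ∃ z ∈ circleIn Γ, g' = g * z := ⟨_, hg, by group⟩
    obtain ⟨w, hw, rfl⟩ : ∃ w ∈ circleIn Γ, h' = h * w := ⟨_, hh, by group⟩
    have hz' : ∀ a : Γ, a * z = z * a := fun a =>
      Subtype.ext (Subgroup.mem_center_iff.mp (Subgroup.mem_subgroupOf.mp hz) a)
    have hw' : ∀ a : Γ, a * w = w * a := fun a =>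
      Subtype.ext (Subgroup.mem_center_iff.mp (Subgroup.mem_subgroupOf.mp hw) a)
    change g * h * g⁻¹ * h⁻¹ = g * z * (h * w) * (g * z)⁻¹ * (h * w)⁻¹
    have e1 : g * z * (h * w) = g * h * (z * w) := by
      rw [mul_assoc, ← mul_assoc z, ← hz' h]; group
    have e2 : (g * z)⁻¹ * (h * w)⁻¹ = (z * w)⁻¹ * (g⁻¹ * h⁻¹) := by
      rw [← mul_inv_rev, ← mul_inv_rev, ← mul_inv_rev]
      congr 1
      rw [mul_assoc, ← mul_assoc w, ← hw' g, mul_assoc g, ← hw' z]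
      group
    rw [mul_assoc _ (g * z)⁻¹, e1, e2]
    group)

theorem commForm_mk {n : ℕ} (Γ : Subgroup (U n)) (g h : Γ) :
    commForm Γ (QuotientGroup.mk g) (QuotientGroup.mk h) =
      g * h * g⁻¹ * h⁻¹ := rfl

/-- The orthogonal complement of a subgroup (that is, a subspace) `W` of `Γ / S¹`. -/
def perp {n : ℕ} {Γ : Subgroup (U n)} (W : Subgroup (Γ ⧸ circleIn Γ)) : Set (Γ ⧸ circleIn Γ) :=
  {x | ∀ y ∈ W, commForm Γ x y = 1}

/-- A subgroup of `Γ` is coisotropic if it is the inverse image of a subspace `W` of `Γ / S¹` with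
`W^⊥ ⊆ W`. -/
def IsCoisotropic {n : ℕ} {Γ : Subgroup (U n)} (J : Subgroup Γ) : Prop :=
  ∃ W : Subgroup (Γ ⧸ circleIn Γ), perp W ⊆ W ∧ J = W.comap (QuotientGroup.mk' (circleIn Γ))

/-- The symplectic Tits building: the poset, under inclusion, of proper coisotropic subgroups. -/
def SymplecticTits {n : ℕ} (Γ : Subgroup (U n)) : Type :=
  {J : Subgroup Γ // IsCoisotropic J ∧ J ≠ ⊤}

instance {n : ℕ} (Γ : Subgroup (U n)) : PartialOrder (SymplecticTits Γ) :=
  inferInstanceAs (PartialOrder {J : Subgroup Γ // IsCoisotropic J ∧ J ≠ ⊤})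

/-- The symplectic Tits building is a discrete poset. -/
instance {n : ℕ} (Γ : Subgroup (U n)) : TopologizedPoset (SymplecticTits Γ) where
  toTopologicalSpace := ⊥
  morTopology := ⊥

/-! ### Existence of `Γ_k` -/

namespace StdGamma

variable (p k : ℕ) [Fact p.Prime]

/-- An indexing of the standard basis of `ℂ^{p^k}` by `(ℤ/p)^k`. -/
noncomputable def index : Fin (p ^ k) ≃ (Fin k → ZMod p) :=
  Fintype.equivOfCardEq (by simp [ZMod.card])

variable {p k}

/-- The monomial matrix `c T_a M_b`, where `T_a` translates the basis by `a` and `M_b` is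
diagonal with entries given by the character `b`. -/
noncomputable def mat (c : ℂ) (a b : Fin k → ZMod p) : Matrix (Fin (p ^ k)) (Fin (p ^ k)) ℂ :=
  Matrix.of fun i j => if index p k i = index p k j + a then
    c * ZMod.stdAddChar (b ⬝ᵥ index p k j) else 0

theorem mat_mul (c c' : ℂ) (a b a' b' : Fin k → ZMod p) :
    mat c a b * mat c' a' b' = mat (c * c' * ZMod.stdAddChar (b ⬝ᵥ a')) (a + a') (b + b') := by
  ext i l
  rw [Matrix.mul_apply, Finset.sum_eq_single ((index p k).symm (index p k l + a'))]
  · simp only [mat, Matrix.of_apply, Equiv.apply_symm_apply, if_true, add_dotProduct,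
      dotProduct_add, AddChar.map_add_eq_mul]
    rw [show index p k l + a' + a = index p k l + (a + a') by abel]
    split_ifs
    · ring
    · simp
  · intro j _ hj
    have : index p k j ≠ index p k l + a' := fun h => hj (by rw [← h]; simp)
    simp [mat, this]
  · simp

theorem mat_one : mat (1 : ℂ) (0 : Fin k → ZMod p) 0 = 1 := by
  ext i j
  simp [mat, Matrix.one_apply]

theorem mat_star (c : ℂ) (a b : Fin k → ZMod p) :
    star (mat c a b) = mat (star c * ZMod.stdAddChar (b ⬝ᵥ a)) (-a) (-b) := by
  ext i j
  have hs : ∀ x : ZMod p, star (ZMod.stdAddChar x : ℂ) = ZMod.stdAddChar (-x) := fun x => by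
    rw [ZMod.stdAddChar_apply, ZMod.stdAddChar_apply, AddChar.map_neg_eq_inv, Circle.coe_inv_eq_conj]
    rfl
  rw [Matrix.star_apply]
  simp only [mat, Matrix.of_apply]
  by_cases h : index p k j = index p k i + a
  · have h2 : index p k i = index p k j + -a := by rw [h]; abel
    rw [if_pos h, if_pos h2, star_mul', hs, mul_assoc, ← AddChar.map_add_eq_mul, h2]
    congr 2
    simp [dotProduct_add]
  · have h2 : index p k i ≠ index p k j + -a := fun h2 => h (by rw [h2]; abel)
    rw [if_neg h, if_neg h2, star_zero]

theorem mat_injective {c c' : ℂ} {a a' b b' : Fin k → ZMod p} (hc : c ≠ 0)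
    (h : mat c a b = mat c' a' b') : c = c' ∧ a = a' ∧ b = b' := by
  have hψ : ∀ x : ZMod p, (ZMod.stdAddChar x : ℂ) ≠ 0 := fun x => by
    rw [ZMod.stdAddChar_apply]; exact Circle.coe_ne_zero _
  have key : ∀ x : Fin k → ZMod p, (a = a') ∧
      c * ZMod.stdAddChar (b ⬝ᵥ x) = c' * ZMod.stdAddChar (b' ⬝ᵥ x) := by
    intro x
    have h1 := congrFun (congrFun h ((index p k).symm (x + a))) ((index p k).symm x)
    simp only [mat, Matrix.of_apply, Equiv.apply_symm_apply, if_true] at h1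
    split_ifs at h1 with h2
    · exact ⟨add_left_cancel h2, h1⟩
    · exact absurd h1 (mul_ne_zero hc (hψ _))
  have hcc : c = c' := by simpa using (key 0).2
  refine ⟨hcc, (key 0).1, funext fun i => ?_⟩
  have := (key (Pi.single i 1)).2
  rw [← hcc] at this
  simpa using ZMod.injective_stdAddChar (mul_left_cancel₀ hc this)

theorem star_mul_circle (c : Circle) : star (c : ℂ) * c = 1 := by
  have := Circle.normSq_coe c
  rw [← Complex.ofReal_one, ← this, Complex.normSq_eq_conj_mul_self]
  rfl

theorem mat_mem (c : Circle) (a b : Fin k → ZMod p) :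
    mat (c : ℂ) a b ∈ Matrix.unitaryGroup (Fin (p ^ k)) ℂ := by
  rw [Matrix.mem_unitaryGroup_iff', mat_star, mat_mul, ← mat_one]
  congr 1
  · have h1 : (ZMod.stdAddChar (-b ⬝ᵥ a) : ℂ) * ZMod.stdAddChar (b ⬝ᵥ a) = 1 := by
      rw [← AddChar.map_add_eq_mul]; simp
    linear_combination star (c : ℂ) * (c : ℂ) * h1 + star_mul_circle c
  · abel
  · abel

/-- The matrix `c T_a M_b` as an element of the unitary group. -/
noncomputable def elt (c : Circle) (a b : Fin k → ZMod p) : U (p ^ k) := ⟨mat c a b, mat_mem c a b⟩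

theorem elt_mul (c c' : Circle) (a b a' b' : Fin k → ZMod p) :
    elt c a b * elt c' a' b' = elt (c * c' * ZMod.toCircle (b ⬝ᵥ a')) (a + a') (b + b') :=
  Subtype.ext (mat_mul _ _ _ _ _ _)

theorem elt_one : elt (1 : Circle) (0 : Fin k → ZMod p) 0 = 1 := Subtype.ext (by
  change mat ((1 : Circle) : ℂ) 0 0 = 1
  rw [Circle.coe_one, mat_one])

theorem elt_inv (c : Circle) (a b : Fin k → ZMod p) :
    (elt c a b)⁻¹ = elt (c⁻¹ * ZMod.toCircle (b ⬝ᵥ a)) (-a) (-b) := by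
  rw [inv_eq_iff_mul_eq_one, elt_mul, ← elt_one]
  congr 1
  · simp only [dotProduct_neg, AddChar.map_neg_eq_inv]
    rw [← mul_assoc, mul_inv_cancel, one_mul, mul_inv_cancel]
  · abel
  · abel

theorem elt_injective {c c' : Circle} {a a' b b' : Fin k → ZMod p}
    (h : elt c a b = elt c' a' b') : c = c' ∧ a = a' ∧ b = b' := by
  obtain ⟨h1, h2⟩ := mat_injective (Circle.coe_ne_zero c) (congrArg Subtype.val h)
  exact ⟨Circle.ext h1, h2⟩

variable (p k)

/-- The group `Γ_k`, generated by the scalars, the translations of the basis by `(ℤ/p)^k`, and the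
diagonal matrices of the characters of `(ℤ/p)^k`. -/
noncomputable def group : Subgroup (U (p ^ k)) where
  carrier := {u | ∃ c a b, u = elt c a b}
  mul_mem' := by
    rintro _ _ ⟨c, a, b, rfl⟩ ⟨c', a', b', rfl⟩
    exact ⟨_, _, _, elt_mul _ _ _ _ _ _⟩
  one_mem' := ⟨1, 0, 0, elt_one.symm⟩
  inv_mem' := by
    rintro _ ⟨c, a, b, rfl⟩
    exact ⟨_, _, _, elt_inv _ _ _⟩

/-- The projection of `Γ_k` onto `(ℤ/p)^k × (ℤ/p)^k`. -/
noncomputable def proj : group p k →* Multiplicative ((Fin k → ZMod p) × (Fin k → ZMod p)) :=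
  MonoidHom.mk' (fun u => Multiplicative.ofAdd
      (u.2.choose_spec.choose, u.2.choose_spec.choose_spec.choose)) (by
    intro u v
    have hu := u.2.choose_spec.choose_spec.choose_spec
    have hv := v.2.choose_spec.choose_spec.choose_spec
    have huv := (u * v).2.choose_spec.choose_spec.choose_spec
    have h : ((u * v : group p k) : U (p ^ k)) = (u : U (p ^ k)) * v := rfl
    have h2 := h
    conv_rhs at h2 => rw [hu, hv, elt_mul]
    obtain ⟨-, h3, h4⟩ := elt_injective (huv.symm.trans h2)
    exact congrArg Multiplicative.ofAdd (Prod.ext h3 h4))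

variable {p k}

theorem proj_elt (c : Circle) (a b : Fin k → ZMod p) (h : elt c a b ∈ group p k) :
    proj p k ⟨elt c a b, h⟩ = Multiplicative.ofAdd (a, b) := by
  obtain ⟨-, h3, h4⟩ := elt_injective (h.choose_spec.choose_spec.choose_spec)
  exact congrArg Multiplicative.ofAdd (Prod.ext h3.symm h4.symm)

theorem mem_center_iff (u : U (p ^ k)) :
    u ∈ Subgroup.center (U (p ^ k)) ↔ ∃ c : Circle, u = elt c 0 0 := by
  constructor
  · intro hu
    have comm : ∀ (a b : Fin k → ZMod p) (i j : Fin (p ^ k)),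
        (u.1 * mat 1 a b) i j = (mat 1 a b * u.1) i j := by
      intro a b i j
      have := congrArg Subtype.val (Subgroup.mem_center_iff.mp hu (elt 1 a b))
      change mat ((1 : Circle) : ℂ) a b * u.1 = u.1 * mat ((1 : Circle) : ℂ) a b at this
      rw [Circle.coe_one] at this
      rw [this]
    have hl : ∀ (a b : Fin k → ZMod p) (i j : Fin (p ^ k)),
        (u.1 * mat 1 a b) i j =
          u.1 i ((index p k).symm (index p k j + a)) * ZMod.stdAddChar (b ⬝ᵥ index p k j) := by
      intro a b i j
      rw [Matrix.mul_apply, Finset.sum_eq_single ((index p k).symm (index p k j + a))]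
      · simp [mat]
      · intro l _ hl
        have : index p k l ≠ index p k j + a := fun h => hl (by rw [← h]; simp)
        simp [mat, this]
      · simp
    have hr : ∀ (a b : Fin k → ZMod p) (i j : Fin (p ^ k)),
        (mat 1 a b * u.1) i j =
          ZMod.stdAddChar (b ⬝ᵥ (index p k i - a)) * u.1 ((index p k).symm (index p k i - a)) j := by
      intro a b i j
      rw [Matrix.mul_apply, Finset.sum_eq_single ((index p k).symm (index p k i - a))]
      · simp [mat]
      · intro l _ hl
        have : index p k i ≠ index p k l + a := fun h => hl (by rw [h]; simp)
        simp [mat, this]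
      · simp
    have hoff : ∀ i j, i ≠ j → u.1 i j = 0 := by
      intro i j hij
      by_contra h0
      refine hij ((index p k).injective (funext fun t => ?_))
      have := comm 0 (Pi.single t 1) i j
      rw [hl, hr] at this
      simp only [add_zero, sub_zero, Equiv.symm_apply_apply, single_one_dotProduct] at this
      rw [mul_comm] at this
      exact (ZMod.injective_stdAddChar (mul_right_cancel₀ h0 this)).symm
    have hdiag : ∀ i j, u.1 i i = u.1 j j := by
      intro i j
      have := comm (index p k i - index p k j) 0 i j
      rw [hl, hr] at this
      simpa using this
    have j0 : Fin (p ^ k) := ⟨0, pow_pos (Fact.out : p.Prime).pos k⟩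
    have hmat : u.1 = mat (u.1 j0 j0) 0 0 := by
      ext i j
      by_cases hij : i = j
      · subst hij; simp [mat, hdiag i j0]
      · simp [mat, hij, hoff i j hij]
    have hnorm : star (u.1 j0 j0) * u.1 j0 j0 = 1 := by
      have h1 : star u.1 * u.1 = 1 := Unitary.coe_star_mul_self u
      rw [hmat, mat_star, mat_mul, ← mat_one] at h1
      have h2 := congrFun (congrFun h1 j0) j0
      simpa [mat] using h2
    have hc : ‖u.1 j0 j0‖ = 1 := by
      have := congrArg norm hnorm
      rw [norm_mul, norm_star, norm_one] at this
      nlinarith [norm_nonneg (u.1 j0 j0)]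
    exact ⟨⟨u.1 j0 j0, mem_sphere_zero_iff_norm.2 hc⟩, Subtype.ext hmat⟩
  · rintro ⟨c, rfl⟩
    rw [Subgroup.mem_center_iff]
    intro g
    have h1 : mat (c : ℂ) (0 : Fin k → ZMod p) 0 = (c : ℂ) • 1 := by
      rw [← mat_one]; ext i j; simp [mat]
    refine Subtype.ext ?_
    change g.1 * mat (c : ℂ) 0 0 = mat (c : ℂ) 0 0 * g.1
    rw [h1]; simp

theorem proj_surjective : Function.Surjective (proj p k) := by
  intro x
  exact ⟨⟨elt 1 x.toAdd.1 x.toAdd.2, _, _, _, rfl⟩, proj_elt _ _ _ _⟩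

theorem proj_ker : (proj p k).ker = circleIn (group p k) := by
  ext ⟨u, hu⟩
  rw [MonoidHom.mem_ker, Subgroup.mem_subgroupOf]
  change _ ↔ u ∈ _
  rw [mem_center_iff]
  obtain ⟨c, a, b, rfl⟩ := id hu
  rw [proj_elt]
  constructor
  · intro h
    have h2 : (a, b) = 0 := h
    simp only [Prod.mk_eq_zero] at h2
    exact ⟨c, by rw [h2.1, h2.2]⟩
  · rintro ⟨c', h⟩
    obtain ⟨-, rfl, rfl⟩ := elt_injective h
    rfl

/-- The group `Γ_k` exists. -/
theorem isGammaSubgroup : IsGammaSubgroup p k (group p k) where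
  center_le u hu := by
    obtain ⟨c, rfl⟩ := (mem_center_iff u).mp hu
    exact ⟨_, _, _, rfl⟩
  quotient := by
    have e1 : ((Fin k → ZMod p) × (Fin k → ZMod p)) ≃ₗ[ZMod p] (Fin (2 * k) → ZMod p) :=
      LinearEquiv.ofFinrankEq _ _ (by simp [two_mul])
    exact ⟨(QuotientGroup.quotientMulEquivOfEq proj_ker.symm).trans
      ((QuotientGroup.quotientKerEquivOfSurjective _ proj_surjective).trans
        e1.toAddEquiv.toMultiplicative)⟩
  irreducible := by
    have j0 : Fin (p ^ k) := ⟨0, pow_pos (Fact.out : p.Prime).pos k⟩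
    have hact : ∀ (W : Subrepresentation
        ((stdRep (p ^ k)).comp (group p k).subtype :
          Representation ℂ (group p k) (EuclideanSpace ℂ (Fin (p ^ k)))))
        (a b : Fin k → ZMod p) (w : EuclideanSpace ℂ (Fin (p ^ k))), w ∈ W →
        stdRep (p ^ k) (elt 1 a b) w ∈ W := fun W a b w hw =>
      W.apply_mem_toSubmodule ⟨elt 1 a b, _, _, _, rfl⟩ hw
    have hval : ∀ (a b : Fin k → ZMod p) (w : EuclideanSpace ℂ (Fin (p ^ k))) (i : Fin (p ^ k)),
        stdRep (p ^ k) (elt 1 a b) w i = ZMod.stdAddChar (b ⬝ᵥ (index p k i - a)) *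
          w ((index p k).symm (index p k i - a)) := by
      intro a b w i
      change (Matrix.mulVec (mat ((1 : Circle) : ℂ) a b) w.ofLp) i = _
      rw [Matrix.mulVec, dotProduct,
        Finset.sum_eq_single ((index p k).symm (index p k i - a))]
      · simp [mat]
      · intro l _ hl
        have : index p k i ≠ index p k l + a := fun h => hl (by rw [h]; simp)
        simp [mat, this]
      · simp
    have hnt : Nontrivial (Subrepresentation
        ((stdRep (p ^ k)).comp (group p k).subtype :
          Representation ℂ (group p k) (EuclideanSpace ℂ (Fin (p ^ k))))) := by
      refine ⟨⊥, ⊤, fun h => ?_⟩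
      have h1 : EuclideanSpace.single j0 (1 : ℂ) ∈ (⊥ : Subrepresentation
        ((stdRep (p ^ k)).comp (group p k).subtype :
          Representation ℂ (group p k) (EuclideanSpace ℂ (Fin (p ^ k))))).toSubmodule := by
        rw [h]; trivial
      have h2 : EuclideanSpace.single j0 (1 : ℂ) = 0 := h1
      have h3 := congrArg (fun w : EuclideanSpace ℂ (Fin (p ^ k)) => w j0) h2
      simp at h3
    refine { eq_bot_or_eq_top := fun W => ?_ }
    by_cases hW : ∀ w ∈ W, w = 0
    · left
      refine Subrepresentation.toSubmodule_injective ?_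
      exact (Submodule.eq_bot_iff _).mpr hW
    · right
      push Not at hW
      obtain ⟨w, hw, hw0⟩ := hW
      obtain ⟨j, hj⟩ : ∃ j, w j ≠ 0 := by
        by_contra! h
        exact hw0 (PiLp.ext h)
      have hsum : ∑ b : Fin k → ZMod p, (ZMod.stdAddChar (-(b ⬝ᵥ index p k j)) : ℂ) •
          stdRep (p ^ k) (elt 1 0 b) w ∈ W.toSubmodule :=
        Submodule.sum_mem _ fun b _ => Submodule.smul_mem _ _ (hact W 0 b w hw)
      have hsum' : ∑ b : Fin k → ZMod p, (ZMod.stdAddChar (-(b ⬝ᵥ index p k j)) : ℂ) •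
          stdRep (p ^ k) (elt 1 0 b) w =
          ((p : ℂ) ^ k * w j) • EuclideanSpace.single j (1 : ℂ) := by
        ext i
        simp only [WithLp.ofLp_sum, Finset.sum_apply, PiLp.smul_apply, hval, sub_zero,
          Equiv.symm_apply_apply, smul_eq_mul, PiLp.single_apply]
        simp only [← mul_assoc, ← AddChar.map_add_eq_mul]
        rw [← Finset.sum_mul]
        by_cases hij : i = j
        · subst hij
          simp [ZMod.card]
        · rw [if_neg hij, mul_zero]
          obtain ⟨t, ht⟩ : ∃ t, index p k i t ≠ index p k j t := by
            by_contra! h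
            exact hij ((index p k).injective (funext h))
          let χ : AddChar (Fin k → ZMod p) ℂ :=
            ⟨fun b => ZMod.stdAddChar (-(b ⬝ᵥ index p k j) + b ⬝ᵥ index p k i), by simp, by
              intro b b'
              rw [← AddChar.map_add_eq_mul, add_dotProduct, add_dotProduct]
              congr 1; ring⟩
          have hχ : χ ≠ 1 := by
            intro h
            have h1 : χ (Pi.single t 1) = 1 := by rw [h]; rfl
            change (ZMod.stdAddChar _ : ℂ) = 1 at h1
            rw [single_one_dotProduct, single_one_dotProduct,
              ← AddChar.map_zero_eq_one (ZMod.stdAddChar (N := p))] at h1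
            have := ZMod.injective_stdAddChar h1
            exact ht (by linear_combination this)
          have h0 : ∑ b, χ b = 0 := AddChar.sum_eq_zero_of_ne_one hχ
          change (∑ b, χ b) * _ = 0
          rw [h0, zero_mul]
      rw [hsum'] at hsum
      have hp : ((p : ℂ) ^ k * w j) ≠ 0 :=
        mul_ne_zero (pow_ne_zero _ (Nat.cast_ne_zero.mpr (Fact.out : p.Prime).ne_zero)) hj
      have hsj : EuclideanSpace.single j (1 : ℂ) ∈ W.toSubmodule :=
        (Submodule.smul_mem_iff _ hp).mp hsum
      have hsi : ∀ i, EuclideanSpace.single i (1 : ℂ) ∈ W.toSubmodule := by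
        intro i
        have h1 := hact W (index p k i - index p k j) 0 _ hsj
        suffices h2 : EuclideanSpace.single i (1 : ℂ) =
            stdRep (p ^ k) (elt 1 (index p k i - index p k j) 0) (EuclideanSpace.single j 1) by
          rw [h2]; exact h1
        ext l
        rw [hval]
        simp only [zero_dotProduct, AddChar.map_zero_eq_one, one_mul, PiLp.single_apply]
        congr 1
        rw [Equiv.symm_apply_eq, eq_iff_iff]
        constructor
        · rintro rfl; abel
        · intro h
          exact (index p k).injective (by
            have := sub_eq_iff_eq_add.mp h
            rw [this]; abel)
      refine Subrepresentation.toSubmodule_injective (top_le_iff.mp ?_)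
      intro x _
      have hx : x = ∑ i, x i • EuclideanSpace.single i (1 : ℂ) := by
        ext l
        simp [WithLp.ofLp_sum, Finset.sum_apply, Pi.single_apply]
      rw [hx]
      exact Submodule.sum_mem _ fun i _ => Submodule.smul_mem _ _ (hsi i)

end StdGamma

/-! Algebra. Let Q = Γ/S¹, of order p^{2k}. By Schur's lemma an element commuting with all of Γ is a
scalar, so the commutator pairing on Q is nondegenerate. Hence noncentral elements have trace zero,
lifts of the elements of Q are linearly independent, and by counting they form a basis of
End(ℂ^{p^k}). Conjugation by an element of Γ scales each basis vector by a value of the pairing, so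
the commutant of the preimage of W ≤ Q has dimension at most |W^⊥| = [Q : W]
(`finrank_commutant_le`).

Let λ be fixed by Γ. Irreducibility makes Γ transitive on its components, and commutativity of Q
makes their isotropy group I independent of the component, so there are [Γ : I] components. The
orthogonal projections onto them are independent and commute with I, and their number meets the
bound above, so they span the commutant. Thus every operator commuting with I is a scalar on each
component (`exists_apply_eq_smul`). Applied to elements of W^⊥, this shows that I is coisotropic;
applied to invariant projections, that components are irreducible and that the order on
decompositions is inclusion of isotropy groups; applied to intertwiners, that the components are the
isotypical summands. Conversely, for coisotropic H over W, the preimage of W^⊥ is abelian, and its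
joint eigenspaces form a fixed decomposition with isotropy W^⊥⊥ = W (`exists_isotropy_eq`).

Topology. The fixed poset is now finite. Orbits of the compact group U(n) with closed stabilizers
are Hausdorff, so continuous functions separate finitely many points; both fixed spaces are
therefore discrete and the bijections are homeomorphisms. An automorphism fixing a point of the
realization fixes each vertex of its supporting chain, so fixed points come from the fixed poset.
The separating functions extend affinely to the realization and recover barycentric coordinates;
compactness then makes the comparison map an embedding (`Realization.isEmbedding_map`). -/

/-! ### Functoriality of nerves and realizations -/

namespace Nerve

variable {P Q : Type*} [PartialOrder P] [PartialOrder Q]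

theorem continuous_vertex [TopologizedPoset P] {m : ℕ} (i : Fin (m + 1)) :
    Continuous (vertex i : Nerve P m → P) :=
  continuous_iff_le_induced.2 (inf_le_left.trans (iInf_le _ i))

theorem continuous_edge [TopologizedPoset P] {m : ℕ} (i : Fin m) :
    Continuous (edge i : Nerve P m → Mor P) :=
  continuous_iff_le_induced.2 (inf_le_right.trans (iInf_le _ i))

theorem continuous_map [TopologizedPoset P] [TopologizedPoset Q] {f : P →o Q}
    (hf : Continuous f) (hf' : Continuous (Mor.map f)) (m : ℕ) :
    Continuous (map f m : Nerve P m → Nerve Q m) := by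
  refine continuous_inf_rng.2 ⟨continuous_iInf_rng.2 fun i => continuous_induced_rng.2 ?_,
    continuous_iInf_rng.2 fun i => continuous_induced_rng.2 ?_⟩
  · exact hf.comp (continuous_vertex i)
  · exact hf'.comp (continuous_edge i)

end Nerve

namespace Realization

variable {P Q R : Type*} [PartialOrder P] [PartialOrder Q] [PartialOrder R]

theorem map_map (f : P →o Q) (g : Q →o R) (x : Realization P) :
    map g (map f x) = map (g.comp f) x := by
  induction x using Quot.ind
  rfl

theorem map_id (x : Realization P) : map OrderHom.id x = x := by
  induction x using Quot.ind
  rfl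

theorem continuous_map [TopologizedPoset P] [TopologizedPoset Q] {f : P →o Q}
    (hf : Continuous f) (hf' : Continuous (Mor.map f)) : Continuous (map f) := by
  refine continuous_quot_lift _ (continuous_quot_mk.comp (continuous_sigma fun m => ?_))
  exact continuous_sigmaMk.comp (((Nerve.continuous_map hf hf' m).comp continuous_fst).prodMk
    continuous_snd)

end Realization

namespace OrderIso

variable {P Q : Type*} [PartialOrder P] [PartialOrder Q] [TopologizedPoset P] [TopologizedPoset Q]

/-- The map induced on morphisms by an isomorphism of posets, as a bijection. -/
def morEquiv (e : P ≃o Q) : Mor P ≃ Mor Q where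
  toFun := Mor.map (e : P →o Q)
  invFun := Mor.map (e.symm : Q →o P)
  left_inv _ := Subtype.ext (Prod.ext (e.symm_apply_apply _) (e.symm_apply_apply _))
  right_inv _ := Subtype.ext (Prod.ext (e.apply_symm_apply _) (e.apply_symm_apply _))

theorem continuous_mor_map_symm {e : P ≃o Q} (h : IsHomeomorph (Mor.map (e : P →o Q))) :
    Continuous (Mor.map (e.symm : Q →o P)) := by
  have h' : IsHomeomorph e.morEquiv := h
  exact (e.morEquiv.toHomeomorphOfIsInducing h'.isInducing).symm.continuous

theorem continuous_symm_of_isHomeomorph {e : P ≃o Q} (h : IsHomeomorph e) : Continuous e.symm :=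
  (e.toEquiv.toHomeomorphOfIsInducing h.isInducing).symm.continuous

theorem isHomeomorph_nerve_map {e : P ≃o Q} (h : IsHomeomorph e)
    (h' : IsHomeomorph (Mor.map (e : P →o Q))) (m : ℕ) :
    IsHomeomorph (Nerve.map (e : P →o Q) m) := by
  refine (Homeomorph.isHomeomorph (⟨⟨_, Nerve.map (e.symm : Q →o P) m, fun _ => ?_, fun _ => ?_⟩,
    Nerve.continuous_map h.continuous h'.continuous m,
    Nerve.continuous_map (continuous_symm_of_isHomeomorph h) (continuous_mor_map_symm h') m⟩ :
      Nerve P m ≃ₜ Nerve Q m) :)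
  · exact OrderHom.ext _ _ (funext fun _ => e.symm_apply_apply _)
  · exact OrderHom.ext _ _ (funext fun _ => e.apply_symm_apply _)

/-- The homeomorphism of geometric realizations induced by an isomorphism of topologized posets. -/
noncomputable def realizationHomeomorph (e : P ≃o Q) (h : IsHomeomorph e)
    (h' : IsHomeomorph (Mor.map (e : P →o Q))) : Realization P ≃ₜ Realization Q where
  toFun := Realization.map (e : P →o Q)
  invFun := Realization.map (e.symm : Q →o P)
  left_inv x := by
    rw [Realization.map_map]
    convert Realization.map_id x
    exact OrderHom.ext _ _ (funext fun _ => e.symm_apply_apply _)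
  right_inv x := by
    rw [Realization.map_map]
    convert Realization.map_id x
    exact OrderHom.ext _ _ (funext fun _ => e.apply_symm_apply _)
  continuous_toFun := Realization.continuous_map h.continuous h'.continuous
  continuous_invFun := Realization.continuous_map (continuous_symm_of_isHomeomorph h)
    (continuous_mor_map_symm h')

end OrderIso

/-! ### Barycentric coordinates -/

namespace stdSimplex

/-- Change of variables for pushed-forward weights, by grouping indices along the fibres of `θ`. It
is what makes affine extensions respect the gluing relation. -/
theorem sum_map_mul {m l : ℕ} (θ : Fin m → Fin l) (t : stdSimplex ℝ (Fin m)) (w : Fin l → ℝ) :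
    ∑ j, map θ t j * w j = ∑ i, t i * w (θ i) := by
  classical
  simp only [map_coe, FunOnFinite.linearMap_apply_apply, Finset.sum_mul]
  rw [← Finset.sum_fiberwise Finset.univ θ]
  refine Finset.sum_congr rfl fun j _ => Finset.sum_congr rfl fun i hi => ?_
  rw [(Finset.mem_filter.1 hi).2]

end stdSimplex

namespace Realization

variable {P Q : Type*} [PartialOrder P] [PartialOrder Q]

/-- The extension of a function on the vertices to the realization that is affine on simplices. -/
noncomputable def affineExt (w : P → ℝ) : Realization P → ℝ :=
  Quot.lift (fun x => ∑ i, x.2.2 i * w (x.2.1.vertex i)) (by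
    rintro _ _ ⟨θ, σ, t⟩
    exact (stdSimplex.sum_map_mul θ t fun i => w (σ.vertex i)).symm)

theorem affineExt_mk (w : P → ℝ) {m : ℕ} (σ : Nerve P m) (t : stdSimplex ℝ (Fin (m + 1))) :
    affineExt w (Quot.mk _ ⟨m, σ, t⟩) = ∑ i, t i * w (σ.vertex i) := rfl

theorem affineExt_map (f : P →o Q) (w : Q → ℝ) (x : Realization P) :
    affineExt w (map f x) = affineExt (w ∘ f) x := by
  induction x using Quot.ind
  rfl

theorem continuous_affineExt [TopologizedPoset P] {w : P → ℝ} (hw : Continuous w) :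
    Continuous (affineExt w) := by
  have h : Continuous fun x : Σ m : ℕ, Nerve P m × stdSimplex ℝ (Fin (m + 1)) =>
      ∑ i, x.2.2 i * w (x.2.1.vertex i) := by
    refine continuous_sigma fun m => ?_
    change Continuous fun y : Nerve P m × stdSimplex ℝ (Fin (m + 1)) =>
      ∑ i, y.2.1 i * w (y.1.vertex i)
    refine continuous_finsetSum _ fun i _ => Continuous.mul ?_ ?_
    · exact ((continuous_apply i).comp continuous_subtype_val :
        Continuous fun t : stdSimplex ℝ (Fin (m + 1)) => t.1 i).comp continuous_snd
    · exact hw.comp ((Nerve.continuous_vertex i).comp continuous_fst)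
  exact continuous_quot_lift _ h

open scoped Classical in
/-- The barycentric coordinate of a point of the realization at the vertex `a`. -/
noncomputable def coord (x : Realization P) (a : P) : ℝ := affineExt (Pi.single a 1) x

open scoped Classical in
theorem coord_mk {m : ℕ} (σ : Nerve P m) (t : stdSimplex ℝ (Fin (m + 1))) (a : P) :
    coord (Quot.mk _ ⟨m, σ, t⟩) a = ∑ i with σ.vertex i = a, t i := by
  simp [coord, affineExt_mk, Finset.sum_filter, Pi.single_apply]

theorem coord_pos_iff {m : ℕ} (σ : Nerve P m) (t : stdSimplex ℝ (Fin (m + 1))) (a : P) :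
    0 < coord (Quot.mk _ ⟨m, σ, t⟩) a ↔ ∃ i, 0 < t i ∧ σ.vertex i = a := by
  classical
  rw [coord_mk, Finset.sum_pos_iff_of_nonneg fun i _ => stdSimplex.zero_le t i]
  simp [and_comm]

theorem exists_coord_pos (x : Realization P) : ∃ a, 0 < coord x a := by
  obtain ⟨⟨m, σ, t⟩, rfl⟩ := Quot.exists_rep x
  have : ∃ i, 0 < t i := by
    by_contra! h
    have h1 := stdSimplex.sum_eq_one t
    have h2 : ∑ i, t i ≤ 0 := Finset.sum_nonpos fun i _ => h i
    linarith
  obtain ⟨i, hi⟩ := this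
  exact ⟨σ.vertex i, (coord_pos_iff σ t _).2 ⟨i, hi, rfl⟩⟩

/-- The support of a point of the realization. -/
def support (x : Realization P) : Set P := {a | 0 < coord x a}

theorem support_mk {m : ℕ} (σ : Nerve P m) (t : stdSimplex ℝ (Fin (m + 1))) :
    support (Quot.mk _ ⟨m, σ, t⟩) = σ.vertex '' {i | 0 < t i} := by
  ext a; exact coord_pos_iff σ t a

theorem finite_support (x : Realization P) : (support x).Finite := by
  obtain ⟨⟨m, σ, t⟩, rfl⟩ := Quot.exists_rep x
  rw [support_mk]
  exact Set.toFinite _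

end Realization

/-! ### Carrier simplices, uniqueness of coordinates, and fixed points -/

namespace Realization

variable {P Q : Type*} [PartialOrder P] [PartialOrder Q]

/-- Every point lies on the simplex spanned by its support. -/
theorem eq_mk_of_range_eq_support (x : Realization P) {s : ℕ} (τ : Nerve P s)
    (hτ : StrictMono τ.vertex) (hr : Set.range τ.vertex = support x) :
    ∃ u : stdSimplex ℝ (Fin (s + 1)),
      (∀ j, u j = coord x (τ.vertex j)) ∧ x = Quot.mk _ ⟨s, τ, u⟩ := by
  classical
  obtain ⟨⟨m, σ, t⟩, rfl⟩ := Quot.exists_rep x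
  suffices h : ∃ u : stdSimplex ℝ (Fin (s + 1)),
      (Quot.mk _ ⟨m, σ, t⟩ : Realization P) = Quot.mk _ ⟨s, τ, u⟩ by
    obtain ⟨u, hu⟩ := h
    refine ⟨u, fun j => ?_, hu⟩
    rw [hu, coord_mk, Finset.sum_eq_single j]
    · intro b hb hbj
      exact absurd (hτ.injective (Finset.mem_filter.1 hb).2) hbj
    · simp
  -- Discard the vertices of weight zero: `θ` enumerates the remaining indices and `t'` is the
  -- restricted weight, which still has total mass one.
  set F : Finset (Fin (m + 1)) := Finset.univ.filter fun i => 0 < t i with hF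
  have hFne : F.Nonempty := by
    obtain ⟨a, ha⟩ := exists_coord_pos (Quot.mk _ ⟨m, σ, t⟩)
    obtain ⟨i, hi, -⟩ := (coord_pos_iff σ t a).1 ha
    exact ⟨i, by simp [hF, hi]⟩
  obtain ⟨r, hr'⟩ : ∃ r, F.card = r + 1 := ⟨F.card - 1, by have := hFne.card_pos; omega⟩
  let θ : Fin (r + 1) ↪o Fin (m + 1) := F.orderEmbOfFin hr'
  have hsum : ∀ w : Fin (m + 1) → ℝ, (∀ i ∉ F, w i = 0) → ∑ i, w (θ i) = ∑ i, w i := by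
    intro w hw
    refine (Finset.sum_map Finset.univ θ.toEmbedding w).symm.trans ?_
    refine Finset.sum_subset (Finset.subset_univ _) fun i _ hi => hw i fun hiF => hi ?_
    have : i ∈ Set.range θ := by rw [Finset.range_orderEmbOfFin]; exact hiF
    obtain ⟨j, rfl⟩ := this
    exact Finset.mem_map_of_mem _ (Finset.mem_univ j)
  have ht0 : ∀ i ∉ F, t i = 0 := fun i hi =>
    le_antisymm (not_lt.1 fun h => hi (by simp [hF, h])) (stdSimplex.zero_le t i)
  let t' : stdSimplex ℝ (Fin (r + 1)) :=
    ⟨fun i => t (θ i), fun i => stdSimplex.zero_le t _, by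
      rw [hsum _ ht0]; exact stdSimplex.sum_eq_one t⟩
  have htt' : stdSimplex.map θ t' = t := by
    ext j
    have h1 := stdSimplex.sum_map_mul θ t' (Pi.single j 1)
    simp only [Pi.single_apply, mul_ite, mul_one, mul_zero, Finset.sum_ite_eq',
      Finset.mem_univ, if_true] at h1
    rw [h1]
    have h2 := hsum (fun i => if i = j then t i else 0) (fun i hi => by simp [ht0 i hi])
    exact h2.trans (by simp)
  have hmem : ∀ i, ∃ j, τ.vertex j = σ.vertex (θ i) := by
    intro i
    have : σ.vertex (θ i) ∈ Set.range τ.vertex := by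
      rw [hr, support_mk]
      have := F.orderEmbOfFin_mem hr' i
      exact ⟨θ i, (Finset.mem_filter.1 this).2, rfl⟩
    exact this
  -- `η` sends each surviving vertex to its place in the strict chain `τ`, merging repetitions. The
  -- point is then glued to `τ` through the common face `σ.pull θ = τ.pull η'`.
  choose η hη using hmem
  let η' : Fin (r + 1) →o Fin (s + 1) := ⟨η, fun i j hij => by
    rw [← hτ.le_iff_le, hη, hη]
    exact OrderHom.monotone σ (θ.monotone hij)⟩
  have hpull : σ.pull (θ : Fin (r + 1) →o Fin (m + 1)) = τ.pull η' :=
    OrderHom.ext _ _ (funext fun i => (hη i).symm)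
  refine ⟨stdSimplex.map η' t', ?_⟩
  have e1 := Quot.sound (Rel.glue (θ : Fin (r + 1) →o Fin (m + 1)) σ t')
  have e2 := Quot.sound (Rel.glue η' τ t')
  rw [hpull] at e1
  refine Eq.trans ?_ (e1.symm.trans e2)
  congr 3
  exact htt'.symm

/-- The support of a point is the vertex set of a strict chain. -/
theorem exists_strictMono_range_eq_support (x : Realization P) :
    ∃ (s : ℕ) (τ : Nerve P s), StrictMono τ.vertex ∧ Set.range τ.vertex = support x := by
  classical
  have hchain : ∀ a b : support x, a ≤ b ∨ b ≤ a := by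
    obtain ⟨⟨m, σ, t⟩, rfl⟩ := Quot.exists_rep x
    rintro ⟨a, ha⟩ ⟨b, hb⟩
    obtain ⟨i, -, rfl⟩ := (coord_pos_iff σ t a).1 ha
    obtain ⟨j, -, rfl⟩ := (coord_pos_iff σ t b).1 hb
    exact (le_total i j).imp (fun h => OrderHom.monotone σ h) (fun h => OrderHom.monotone σ h)
  let _ : LinearOrder (support x) :=
    { (inferInstance : PartialOrder (support x)) with
      le_total := hchain
      toDecidableLE := Classical.decRel _ }
  let _ : Fintype (support x) := (finite_support x).fintype
  obtain ⟨a, ha⟩ := exists_coord_pos x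
  have hpos : 0 < Fintype.card (support x) := Fintype.card_pos_iff.2 ⟨⟨a, ha⟩⟩
  obtain ⟨s, hs⟩ : ∃ s, Fintype.card (support x) = s + 1 := ⟨_, (Nat.succ_pred_eq_of_pos hpos).symm⟩
  let e := monoEquivOfFin (support x) hs
  refine ⟨s, ⟨fun i => (e i : P), fun i j hij => e.monotone hij⟩, fun i j hij => ?_, ?_⟩
  · exact e.strictMono hij
  · exact (e.surjective.range_comp Subtype.val).trans Subtype.range_coe

/-- The coordinates determine the support, hence one strict chain carrying both points; on that
chain the weights are the coordinates themselves. -/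
theorem coord_injective : Function.Injective (coord : Realization P → P → ℝ) := by
  intro x y hxy
  have hs : support x = support y := by simp [support, hxy]
  obtain ⟨s, τ, hτ, hr⟩ := exists_strictMono_range_eq_support x
  obtain ⟨u, hu, rfl⟩ := eq_mk_of_range_eq_support x τ hτ hr
  obtain ⟨v, hv, rfl⟩ := eq_mk_of_range_eq_support y τ hτ (hr.trans hs)
  have : u = v := stdSimplex.ext (funext fun j => by rw [hu, hv, hxy])
  rw [this]

theorem support_map {f : P →o Q} (x : Realization P) : support (map f x) = f '' support x := by
  obtain ⟨⟨m, σ, t⟩, rfl⟩ := Quot.exists_rep x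
  change support (Quot.mk _ ⟨m, σ.map f m, t⟩) = _
  rw [support_mk, support_mk, Set.image_image]
  rfl

/-- An automorphism fixing a point of the realization fixes the support pointwise. -/
theorem eq_of_map_eq {f : P →o P} (hf : StrictMono f) {x : Realization P}
    (hx : map f x = x) {a : P} (ha : a ∈ support x) : f a = a := by
  obtain ⟨s, τ, hτ, hr⟩ := exists_strictMono_range_eq_support x
  have h1 : Set.range (f ∘ τ.vertex) = Set.range τ.vertex := by
    rw [Set.range_comp, hr, ← support_map, hx]
  have h2 : f ∘ τ.vertex = τ.vertex := by
    have hmem : ∀ i, ∃ j, τ.vertex j = f (τ.vertex i) := fun i => by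
      have : (f ∘ τ.vertex) i ∈ Set.range τ.vertex := h1 ▸ Set.mem_range_self i
      exact this
    choose η hη using hmem
    have hη' : StrictMono η := fun i j hij => by
      rw [← hτ.lt_iff_lt, hη, hη]
      exact hf (hτ hij)
    -- `f` permutes the finite chain preserving its order, and a finite linear order has no
    -- automorphism but the identity.
    have : η = id := by
      have := Subsingleton.elim (hη'.orderIsoOfSurjective η
        (Finite.surjective_of_injective hη'.injective)) (OrderIso.refl _)
      exact congrArg (fun e : Fin (s + 1) ≃o Fin (s + 1) => (e : Fin (s + 1) → Fin (s + 1))) this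
    funext i
    rw [Function.comp_apply, ← hη, this, id]
  obtain ⟨i, rfl⟩ : a ∈ Set.range τ.vertex := hr ▸ ha
  exact congrFun h2 i

/-- A point whose support lies in the range of an order embedding is in the image. -/
theorem mem_range_map {f : P ↪o Q} {x : Realization Q} (hx : support x ⊆ Set.range f) :
    x ∈ Set.range (map (f : P →o Q)) := by
  obtain ⟨s, τ, hτ, hr⟩ := exists_strictMono_range_eq_support x
  obtain ⟨u, -, rfl⟩ := eq_mk_of_range_eq_support x τ hτ hr
  have hmem : ∀ i, ∃ b, f b = τ.vertex i := fun i => hx (hr ▸ Set.mem_range_self i)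
  choose σ hσ using hmem
  have hmono : Monotone σ := fun i j hij => by
    rw [← f.le_iff_le, hσ, hσ]
    exact hτ.monotone hij
  let σ' : Nerve P s := OrderHom.mk σ hmono
  have e : σ'.map (f : P →o Q) s = τ := OrderHom.ext _ _ (funext hσ)
  refine ⟨Quot.mk (Rel P) ⟨s, σ', u⟩, ?_⟩
  change Quot.mk (Rel Q) ⟨s, σ'.map (f : P →o Q) s, u⟩ = _
  rw [e]

instance [Finite P] (m : ℕ) : Finite (Nerve P m) :=
  Finite.of_injective (fun σ : Nerve P m => fun i => σ.vertex i)
    fun _ _ h => OrderHom.ext _ _ h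

/-- The realization of a finite topologized poset is compact. -/
instance compactSpace [Finite P] [TopologizedPoset P] : CompactSpace (Realization P) := by
  -- Strict chains have at most `Nat.card P` vertices, so finitely many compact pieces already cover
  -- the realization.
  let q : (Σ m : Fin (Nat.card P), Nerve P m × stdSimplex ℝ (Fin (m + 1))) → Realization P :=
    fun y => Quot.mk _ ⟨y.1, y.2⟩
  have hq : Continuous q := continuous_quot_mk.comp (continuous_sigma fun m =>
    (continuous_sigmaMk (σ := fun m : ℕ => Nerve P m × stdSimplex ℝ (Fin (m + 1)))
      (i := (m : ℕ))))
  have hs : Function.Surjective q := by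
    intro x
    obtain ⟨s, τ, hτ, hr⟩ := exists_strictMono_range_eq_support x
    obtain ⟨u, -, rfl⟩ := eq_mk_of_range_eq_support x τ hτ hr
    have hc : s < Nat.card P := by
      have := Nat.card_le_card_of_injective _ hτ.injective
      rwa [Nat.card_fin] at this
    exact ⟨⟨⟨s, hc⟩, τ, u⟩, rfl⟩
  exact hs.compactSpace hq

end Realization

/-- A finite subposet whose points are separated by continuous functions on the ambient topologized
poset has its realization embedded in the ambient realization. -/
theorem Realization.isEmbedding_map {P Q : Type*} [PartialOrder P] [PartialOrder Q]
    [TopologizedPoset P] [TopologizedPoset Q] [Finite P] {f : P ↪o Q}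
    (hf : Continuous f) (hf' : Continuous (Mor.map (f : P →o Q)))
    (hsep : ∀ a : P, ∃ φ : Q → ℝ, Continuous φ ∧ φ (f a) = 1 ∧ ∀ b ≠ a, φ (f b) = 0) :
    Topology.IsEmbedding (Realization.map (f : P →o Q)) := by
  classical
  choose φ hφ h1 h0 using hsep
  have hc := Realization.continuous_map hf hf'
  -- `φ a` restricts along `f` to the indicator of `a`, so its affine extension restricts to the
  -- coordinate at `a`. The composite with `Realization.map f` is thus a continuous injection from a
  -- compact space to a Hausdorff one.
  let h : Realization Q → P → ℝ := fun y a => Realization.affineExt (φ a) y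
  have hh : Continuous h := continuous_pi fun a => Realization.continuous_affineExt (hφ a)
  have hcomp : h ∘ Realization.map (f : P →o Q) = Realization.coord := by
    funext x a
    change Realization.affineExt _ (Realization.map _ _) = _
    rw [Realization.affineExt_map, Realization.coord]
    congr 1
    ext b
    by_cases hb : b = a
    · subst hb; simp [h1]
    · simp [hb, h0 a b hb]
  have he : Topology.IsEmbedding (h ∘ Realization.map (f : P →o Q)) :=
    ((hh.comp hc).isClosedEmbedding (hcomp ▸ Realization.coord_injective)).isEmbedding
  exact Topology.IsEmbedding.of_comp hc hh he

/-! ### Orbit topologies of compact groups -/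

section OrbitTopology

variable {G X : Type*} [Group G] [TopologicalSpace G] [MulAction G X]

open scoped Topology in
theorem continuous_orbitTopology_iff {Y : Type*} [TopologicalSpace Y] {φ : X → Y} :
    Continuous[orbitTopology G X, _] φ ↔ ∀ x : X, Continuous fun g : G => φ (g • x) := by
  rw [orbitTopology, continuous_iSup_dom]
  exact forall_congr' fun x => continuous_coinduced_dom

open scoped Topology in
/-- Finite sets can be separated from points by continuous functions in the orbit topology. -/
theorem exists_continuous_orbitTopology_eq_one_eq_zero [IsTopologicalGroup G] [CompactSpace G]
    (a : X) (ha : IsClosed (MulAction.stabilizer G a : Set G)) {B : Set X} (hB : B.Finite)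
    (haB : a ∉ B) :
    ∃ φ : X → ℝ, Continuous[orbitTopology G X, _] φ ∧ φ a = 1 ∧ ∀ b ∈ B, φ b = 0 := by
  classical
  let S := MulAction.stabilizer G a
  -- The quotient map is open and its equivalence relation is closed because the stabilizer is.
  have : T2Space (G ⧸ S) := by
    rw [t2Space_iff_of_isOpenQuotientMap (QuotientGroup.isOpenQuotientMap_mk (N := S))]
    have : {q : G × G | (q.1 : G ⧸ S) = (q.2 : G ⧸ S)} =
        (fun q : G × G => q.1⁻¹ * q.2) ⁻¹' (S : Set G) := by
      ext q
      exact QuotientGroup.eq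
    rw [this]
    exact ha.preimage (by fun_prop)
  let o : G ⧸ S → X := MulAction.ofQuotientStabilizer G a
  have ho : Function.Injective o := MulAction.injective_ofQuotientStabilizer G a
  have hfin : (o ⁻¹' B).Finite := hB.preimage ho.injOn
  have hdis : Disjoint (o ⁻¹' B) {((1 : G) : G ⧸ S)} := by
    rw [Set.disjoint_singleton_right]
    intro h
    apply haB
    have h1 : o ((1 : G) : G ⧸ S) ∈ B := h
    rwa [show o ((1 : G) : G ⧸ S) = a from one_smul G a] at h1
  obtain ⟨f, hf0, hf1, -⟩ := exists_continuous_zero_one_of_isClosed hfin.isClosed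
    isClosed_singleton hdis
  -- The Urysohn function on the orbit of `a`, extended by zero to the other orbits; continuity is
  -- checked one orbit at a time.
  refine ⟨Function.extend o f 0, continuous_orbitTopology_iff.2 fun x => ?_, ?_, fun b hb => ?_⟩
  · by_cases hx : ∃ h : G, h • a = x
    · obtain ⟨h, rfl⟩ := hx
      have : (fun g : G => Function.extend o f 0 (g • h • a)) =
          fun g : G => f ((g * h : G) : G ⧸ S) := by
        funext g
        rw [smul_smul]
        exact ho.extend_apply f 0 ((g * h : G) : G ⧸ S)
      rw [this]
      exact f.continuous.comp (QuotientGroup.continuous_mk.comp (continuous_mul_const h))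
    · have : (fun g : G => Function.extend o f 0 (g • x)) = fun _ => 0 := by
        funext g
        refine Function.extend_apply' _ _ _ ?_
        rintro ⟨q, hq⟩
        obtain ⟨h, rfl⟩ := QuotientGroup.mk_surjective q
        refine hx ⟨g⁻¹ * h, ?_⟩
        rw [mul_smul, inv_smul_eq_iff]
        exact hq
      rw [this]
      exact continuous_const
  · have := ho.extend_apply f 0 ((1 : G) : G ⧸ S)
    rw [show o ((1 : G) : G ⧸ S) = a from one_smul G a] at this
    rw [this]
    exact hf1 rfl
  · by_cases hx : ∃ q, o q = b
    · obtain ⟨q, rfl⟩ := hx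
      rw [ho.extend_apply]
      exact hf0 hb
    · exact Function.extend_apply' _ _ _ hx

/-- A finite set mapping injectively to a space with the orbit topology of a compact group with
closed stabilizers is discrete in the induced topology. -/
theorem induced_orbitTopology_eq_bot [IsTopologicalGroup G] [CompactSpace G]
    (hX : ∀ a : X, IsClosed (MulAction.stabilizer G a : Set G)) {Y : Type*} [Finite Y] {f : Y → X}
    (hf : Function.Injective f) : TopologicalSpace.induced f (orbitTopology G X) = ⊥ := by
  let _ := orbitTopology G X
  let _ := TopologicalSpace.induced f (orbitTopology G X)
  have hc : Continuous f := continuous_induced_dom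
  refine eq_bot_of_singletons_open fun y => ?_
  obtain ⟨φ, hφ, h1, h0⟩ := exists_continuous_orbitTopology_eq_one_eq_zero (G := G) (f y) (hX _)
    (Set.toFinite (f '' {y}ᶜ)) (by rintro ⟨z, hz, h⟩; exact hz (hf h))
  have : {y} = (φ ∘ f) ⁻¹' {0}ᶜ := by
    ext z
    by_cases hz : z = y
    · subst hz; simp [h1]
    · simp [hz, h0 _ ⟨z, hz, rfl⟩]
  rw [this]
  exact isOpen_compl_singleton.preimage (hφ.comp hc)

end OrbitTopology

/-! ### Stabilizers in the unitary group are closed -/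

instance Matrix.unitaryGroup.compactSpace (n : ℕ) : CompactSpace (U n) := by
  refine isCompact_iff_compactSpace.1 ?_
  have hK : IsCompact (Set.univ.pi fun _ : Fin n => Set.univ.pi fun _ : Fin n =>
      Metric.closedBall (0 : ℂ) 1) :=
    isCompact_univ_pi fun _ => isCompact_univ_pi fun _ => isCompact_closedBall 0 1
  refine IsCompact.of_isClosed_subset hK ?_ fun A hA i _ j _ => ?_
  · have : {A : Matrix (Fin n) (Fin n) ℂ | A * star A = 1} =
        (Matrix.unitaryGroup (Fin n) ℂ : Set (Matrix (Fin n) (Fin n) ℂ)) := by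
      ext A
      exact Matrix.mem_unitaryGroup_iff.symm
    change IsClosed (Matrix.unitaryGroup (Fin n) ℂ : Set (Matrix (Fin n) (Fin n) ℂ))
    rw [← this]
    exact isClosed_eq (continuous_id.matrix_mul continuous_id.matrix_conjTranspose)
      continuous_const
  · rw [mem_closedBall_zero_iff]
    exact entry_norm_bound_of_unitary hA i j

theorem continuous_stdRep_apply {n : ℕ} (x : EuclideanSpace ℂ (Fin n)) :
    Continuous fun g : U n => stdRep n g x := by
  refine (PiLp.continuous_toLp 2 _).comp ?_
  exact Continuous.matrix_mulVec continuous_subtype_val continuous_const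

namespace OrthDecomp

variable {n : ℕ}

theorem sSupIndep_classes (a : OrthDecomp n) : sSupIndep a.classes := by
  intro v hv
  refine Submodule.IsOrtho.disjoint ?_
  rw [Submodule.isOrtho_sSup_right]
  rintro w ⟨hw, hne⟩
  exact a.orthogonal v hv w hw (Ne.symm hne)

theorem finite_classes (a : OrthDecomp n) : a.classes.Finite :=
  WellFoundedGT.finite_of_sSupIndep a.sSupIndep_classes

/-- For a fixed component of `a`, containment of its translate in a given component of `b` is a
closed condition on `g`. The union over the components of `b` stays closed because there are
finitely many. -/
theorem isClosed_setOf_smul_le (a b : OrthDecomp n) : IsClosed {g : U n | g • a ≤ b} := by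
  have : {g : U n | g • a ≤ b} = ⋂ v ∈ a.classes, ⋃ w ∈ b.classes, ⋂ x ∈ v,
      (fun g : U n => stdRep n g x) ⁻¹' (w : Set (EuclideanSpace ℂ (Fin n))) := by
    ext g
    simp only [Set.mem_iInter, Set.mem_iUnion]
    constructor
    · intro h v hv
      obtain ⟨w, hw, hle⟩ := h (g • v) ⟨v, hv, rfl⟩
      exact ⟨w, hw, fun x hx => hle ⟨x, hx, rfl⟩⟩
    · rintro h _ ⟨v, hv, rfl⟩
      obtain ⟨w, hw, hle⟩ := h v hv
      refine ⟨w, hw, ?_⟩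
      rintro _ ⟨x, hx, rfl⟩
      exact hle x hx
  rw [this]
  refine isClosed_biInter fun v _ => b.finite_classes.isClosed_biUnion fun w _ =>
    isClosed_biInter fun x _ => IsClosed.preimage (continuous_stdRep_apply x) ?_
  exact w.closed_of_finiteDimensional

theorem smul_le_iff (g : U n) (a b : OrthDecomp n) : g • a ≤ b ↔ a ≤ g⁻¹ • b := by
  constructor
  · intro h
    have : g⁻¹ • g • a ≤ g⁻¹ • b := (actHom g⁻¹).monotone h
    rwa [inv_smul_smul] at this
  · intro h
    have : g • a ≤ g • g⁻¹ • b := (actHom g).monotone h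
    rwa [smul_inv_smul] at this

theorem isClosed_stabilizer (a : OrthDecomp n) :
    IsClosed (MulAction.stabilizer (U n) a : Set (U n)) := by
  have : (MulAction.stabilizer (U n) a : Set (U n)) =
      {g : U n | g • a ≤ a} ∩ (fun g => g⁻¹) ⁻¹' {g : U n | g • a ≤ a} := by
    ext g
    rw [SetLike.mem_coe, MulAction.mem_stabilizer_iff, Set.mem_inter_iff, Set.mem_preimage,
      Set.mem_ofPred_eq, Set.mem_ofPred_eq, smul_le_iff g⁻¹, inv_inv]
    exact le_antisymm_iff
  rw [this]
  exact (isClosed_setOf_smul_le a a).inter ((isClosed_setOf_smul_le a a).preimage continuous_inv)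

theorem isClosed_stabilizer_mor (x : Mor (OrthDecomp n)) :
    IsClosed (MulAction.stabilizer (U n) x : Set (U n)) := by
  have : (MulAction.stabilizer (U n) x : Set (U n)) =
      (MulAction.stabilizer (U n) x.1.1 : Set (U n)) ∩ MulAction.stabilizer (U n) x.1.2 := by
    ext g
    exact Subtype.ext_iff.trans Prod.ext_iff
  rw [this]
  exact (isClosed_stabilizer _).inter (isClosed_stabilizer _)

end OrthDecomp

/-! ### Discreteness and realization of the fixed poset -/

namespace FixedDecomp

variable {n : ℕ} (Γ : Subgroup (U n))

theorem incl_injective : Function.Injective (incl Γ) := Subtype.val_injective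

theorem discreteTopology [Finite (FixedDecomp Γ)] : DiscreteTopology (FixedDecomp Γ) :=
  ⟨induced_orbitTopology_eq_bot OrthDecomp.isClosed_stabilizer (incl_injective Γ)⟩

theorem discreteTopology_mor [Finite (FixedDecomp Γ)] :
    DiscreteTopology (Mor (FixedDecomp Γ)) :=
  have : Finite (Mor (FixedDecomp Γ)) := Subtype.finite
  ⟨induced_orbitTopology_eq_bot (f := Mor.map (incl Γ)) OrthDecomp.isClosed_stabilizer_mor
    fun _ _ h => Subtype.ext (Prod.ext (incl_injective Γ (congrArg (fun x => x.1.1) h))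
      (incl_injective Γ (congrArg (fun x => x.1.2) h)))⟩

/-- The realization of the fixed poset is embedded in the realization of all decompositions. -/
theorem isEmbedding_realization_map_incl [Finite (FixedDecomp Γ)] :
    Topology.IsEmbedding (Realization.map (incl Γ)) := by
  refine Realization.isEmbedding_map
    (f := (⟨⟨incl Γ, incl_injective Γ⟩, Iff.rfl⟩ : FixedDecomp Γ ↪o OrthDecomp n))
    continuous_induced_dom continuous_induced_dom fun a => ?_
  obtain ⟨φ, hφ, h1, h0⟩ := exists_continuous_orbitTopology_eq_one_eq_zero (G := U n) (incl Γ a)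
    (OrthDecomp.isClosed_stabilizer _) (Set.toFinite (incl Γ '' {a}ᶜ))
    (by rintro ⟨z, hz, h⟩; exact hz (incl_injective Γ h))
  exact ⟨φ, hφ, h1, fun b hb => h0 _ ⟨b, hb, rfl⟩⟩

/-- Unitary matrices act by strictly monotone maps, so `Realization.eq_of_map_eq` makes a fixed
point have a support consisting of fixed decompositions. -/
theorem range_realization_map_incl :
    Set.range (Realization.map (incl Γ)) = realizationFixedPoints Γ := by
  apply Set.Subset.antisymm
  · rintro _ ⟨x, rfl⟩ g hg
    rw [Realization.map_map]
    congr 1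
    exact OrderHom.ext _ _ (funext fun a => a.2 g hg)
  · intro x hx
    refine Realization.mem_range_map
      (f := (⟨⟨incl Γ, incl_injective Γ⟩, Iff.rfl⟩ : FixedDecomp Γ ↪o OrthDecomp n))
      fun a ha => ?_
    refine ⟨⟨a, fun g hg => ?_⟩, rfl⟩
    exact Realization.eq_of_map_eq ((OrthDecomp.actHom g).monotone.strictMono_of_injective
      (MulAction.injective g)) (hx g hg) ha

/-- The realization of the fixed poset is the fixed point space of the realization. -/
noncomputable def realizationHomeomorph [Finite (FixedDecomp Γ)] :
    Realization (FixedDecomp Γ) ≃ₜ realizationFixedPoints Γ :=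
  (isEmbedding_realization_map_incl Γ).toHomeomorph.trans
    (Homeomorph.setCongr (range_realization_map_incl Γ))

end FixedDecomp

/-! ### Nondegenerate pairings on finite abelian groups -/

section Pairing

variable {Q : Type*} [Group Q]

/-- The left orthogonal complement of a subgroup under a pairing. -/
def pairingPerp (b : Q →* Q →* ℂˣ) (W : Subgroup Q) : Subgroup Q where
  carrier := {x | ∀ y ∈ W, b x y = 1}
  mul_mem' hx hx' y hy := by rw [map_mul, MonoidHom.mul_apply, hx y hy, hx' y hy, one_mul]
  one_mem' y _ := by rw [map_one, MonoidHom.one_apply]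
  inv_mem' hx y hy := by rw [map_inv, MonoidHom.inv_apply, hx y hy, inv_one]

theorem mem_pairingPerp {b : Q →* Q →* ℂˣ} {W : Subgroup Q} {x : Q} :
    x ∈ pairingPerp b W ↔ ∀ y ∈ W, b x y = 1 := Iff.rfl

/-- By counting characters, the injection of `Q` into its dual is onto. Every character of `W`
extends to `Q`, so restriction gives a surjection from `Q` to the dual of `W`, with kernel the
complement. -/
theorem card_pairingPerp_mul_card [Finite Q] (hcomm : ∀ x y : Q, x * y = y * x)
    {b : Q →* Q →* ℂˣ} (hb : Function.Injective b) (W : Subgroup Q) :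
    Nat.card (pairingPerp b W) * Nat.card W = Nat.card Q := by
  let _ : CommGroup Q := { (inferInstance : Group Q) with mul_comm := hcomm }
  have hQ : Nat.card (Q →* ℂˣ) = Nat.card Q :=
    CommGroup.card_monoidHom_of_hasEnoughRootsOfUnity Q ℂ
  have hW : Nat.card (W →* ℂˣ) = Nat.card W :=
    CommGroup.card_monoidHom_of_hasEnoughRootsOfUnity W ℂ
  have : Finite (Q →* ℂˣ) := Nat.finite_of_card_ne_zero (hQ ▸ Nat.card_pos.ne')
  have hsurj : Function.Surjective b :=
    ((Nat.bijective_iff_injective_and_card b).2 ⟨hb, hQ.symm⟩).2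
  let r : Q →* W →* ℂˣ := (MonoidHom.domRestrictHom W ℂˣ).comp b
  have hr : Function.Surjective r := (MonoidHom.domRestrict_surjective ℂ W).comp hsurj
  have hker : r.ker = pairingPerp b W := by
    ext x
    rw [MonoidHom.mem_ker, mem_pairingPerp, MonoidHom.ext_iff]
    exact ⟨fun h y hy => h ⟨y, hy⟩, fun h y => h y y.2⟩
  rw [← hker, ← hW, ← Nat.card_congr (QuotientGroup.quotientKerEquivOfSurjective r hr).toEquiv,
    mul_comm, ← Subgroup.card_eq_card_quotient_mul_card_subgroup]

theorem card_pairingPerp [Finite Q] (hcomm : ∀ x y : Q, x * y = y * x)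
    {b : Q →* Q →* ℂˣ} (hb : Function.Injective b) (W : Subgroup Q) :
    Nat.card (pairingPerp b W) = W.index :=
  Nat.eq_of_mul_eq_mul_right Nat.card_pos
    ((card_pairingPerp_mul_card hcomm hb W).trans W.index_mul_card.symm)

theorem pairingPerp_pairingPerp [Finite Q] (hcomm : ∀ x y : Q, x * y = y * x)
    {b : Q →* Q →* ℂˣ} (hb : Function.Injective b) (hsymm : ∀ x y, b x y = 1 → b y x = 1)
    (W : Subgroup Q) : pairingPerp b (pairingPerp b W) = W := by
  symm
  refine Subgroup.eq_of_le_of_card_ge (fun x hx y hy => hsymm _ _ (hy x hx)) ?_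
  have h1 := card_pairingPerp_mul_card hcomm hb W
  have h2 := card_pairingPerp_mul_card hcomm hb (pairingPerp b W)
  rw [← h1, mul_comm] at h2
  exact (Nat.eq_of_mul_eq_mul_left Nat.card_pos h2).le

end Pairing

/-! ### The standard representation -/

section StdRep

variable {n : ℕ}

theorem stdRep_injective : Function.Injective (stdRep n) := fun _ _ h =>
  Subtype.ext (Matrix.toEuclideanLin.injective h)

theorem stdRep_apply_injective (g : U n) : Function.Injective (stdRep n g) :=
  (stdRep n).apply_bijective g |>.1

theorem mem_smul_submodule {g : U n} {v : Submodule ℂ (EuclideanSpace ℂ (Fin n))}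
    {x : EuclideanSpace ℂ (Fin n)} (hx : x ∈ v) : stdRep n g x ∈ g • v :=
  Submodule.mem_map_of_mem hx

theorem smul_submodule_le_iff {g : U n} {v w : Submodule ℂ (EuclideanSpace ℂ (Fin n))} :
    g • v ≤ w ↔ ∀ x ∈ v, stdRep n g x ∈ w := Submodule.map_le_iff_le_comap

theorem smul_eq_self_of_le {g : U n} {v : Submodule ℂ (EuclideanSpace ℂ (Fin n))}
    (h : g • v ≤ v) : g • v = v :=
  Submodule.eq_of_le_of_finrank_le h
    (Submodule.equivMapOfInjective (stdRep n g) (stdRep_apply_injective g) v).finrank_eq.le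

/-- A unitary operator preserving `w` also preserves its orthogonal complement. -/
theorem starProjection_stdRep {g : U n} {w : Submodule ℂ (EuclideanSpace ℂ (Fin n))}
    (h : g • w = w) (x : EuclideanSpace ℂ (Fin n)) :
    w.starProjection (stdRep n g x) = stdRep n g (w.starProjection x) := by
  refine Submodule.eq_starProjection_of_mem_of_inner_eq_zero ?_ fun y hy => ?_
  · exact h.le (mem_smul_submodule (w.starProjection_apply_mem x))
  · rw [← h] at hy
    obtain ⟨z, hz, rfl⟩ := hy
    rw [← map_sub, stdRep_inner]
    exact w.starProjection_inner_eq_zero x z hz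

/-- The operators commuting with a subgroup `J` of `Γ ≤ U(n)`. -/
noncomputable def commutant {Γ : Subgroup (U n)} (J : Subgroup Γ) :
    Submodule ℂ (Module.End ℂ (EuclideanSpace ℂ (Fin n))) where
  carrier := {T | ∀ h ∈ J, T * stdRep n h = stdRep n h * T}
  add_mem' hS hT h hh := by rw [add_mul, mul_add, hS h hh, hT h hh]
  zero_mem' h _ := by rw [zero_mul, mul_zero]
  smul_mem' c T hT h hh := by rw [smul_mul_assoc, mul_smul_comm, hT h hh]

theorem starProjection_mem_commutant {Γ : Subgroup (U n)} {J : Subgroup Γ}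
    {w : Submodule ℂ (EuclideanSpace ℂ (Fin n))} (h : ∀ g ∈ J, (g : U n) • w = w) :
    (w.starProjection : Module.End ℂ (EuclideanSpace ℂ (Fin n))) ∈ commutant J := fun g hg =>
  LinearMap.ext fun x => starProjection_stdRep (h g hg) x

end StdRep

/-! ### The commutator form and the commutant of a subgroup of `Γ_k` -/

namespace IsGammaSubgroup

variable {p k : ℕ} [Fact p.Prime] {Γ : Subgroup (U (p ^ k))} (hΓ : IsGammaSubgroup p k Γ)

theorem nontrivial_space (p k : ℕ) [Fact p.Prime] :
    Nontrivial (EuclideanSpace ℂ (Fin (p ^ k))) := by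
  have : NeZero (p ^ k) := ⟨pow_ne_zero _ (Fact.out : p.Prime).ne_zero⟩
  infer_instance

include hΓ

omit [Fact p.Prime] in
theorem eq_bot_or_eq_top {M : Submodule ℂ (EuclideanSpace ℂ (Fin (p ^ k)))}
    (hM : ∀ g : Γ, (g : U (p ^ k)) • M ≤ M) : M = ⊥ ∨ M = ⊤ := by
  have := hΓ.irreducible
  let W : Subrepresentation ((stdRep (p ^ k)).comp Γ.subtype :
      Representation ℂ Γ (EuclideanSpace ℂ (Fin (p ^ k)))) :=
    ⟨M, fun g x hx => hM g (mem_smul_submodule hx)⟩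
  exact (IsSimpleOrder.eq_bot_or_eq_top W).imp (congrArg Subrepresentation.toSubmodule)
    (congrArg Subrepresentation.toSubmodule)

/-- Schur's lemma. -/
theorem exists_eq_smul_one {T : Module.End ℂ (EuclideanSpace ℂ (Fin (p ^ k)))}
    (hT : ∀ g : Γ, T * stdRep _ g = stdRep _ g * T) : ∃ c : ℂ, T = c • 1 := by
  have := nontrivial_space p k
  obtain ⟨c, hc⟩ := Module.End.exists_eigenvalue T
  refine ⟨c, LinearMap.ext fun x => ?_⟩
  have hinv : ∀ g : Γ, (g : U (p ^ k)) • Module.End.eigenspace T c ≤ Module.End.eigenspace T c := by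
    refine fun g => smul_submodule_le_iff.2 fun x hx => ?_
    rw [Module.End.mem_eigenspace_iff] at hx ⊢
    rw [← Module.End.mul_apply, hT, Module.End.mul_apply, hx, map_smul]
  rcases hΓ.eq_bot_or_eq_top hinv with h | h
  · exact absurd h hc
  · exact Module.End.mem_eigenspace_iff.1 (h ▸ Submodule.mem_top)

theorem exists_eq_smul_one_of_mem_circleIn {z : Γ} (hz : z ∈ circleIn Γ) :
    ∃ c : ℂˣ, stdRep (p ^ k) z = (c : ℂ) • 1 := by
  have := nontrivial_space p k
  obtain ⟨c, hc⟩ := hΓ.exists_eq_smul_one (T := stdRep (p ^ k) z) (fun g => by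
    rw [← map_mul, ← map_mul, Subgroup.mem_center_iff.1 (Subgroup.mem_subgroupOf.1 hz)])
  refine ⟨Units.mk0 c ?_, hc⟩
  rintro rfl
  rw [zero_smul] at hc
  obtain ⟨x, hx⟩ := exists_ne (0 : EuclideanSpace ℂ (Fin (p ^ k)))
  refine hx (stdRep_apply_injective (z : U (p ^ k)) ?_)
  rw [hc, map_zero, LinearMap.zero_apply]

theorem mem_circleIn_of_commute {z : Γ} (hz : ∀ g : Γ, z * g = g * z) : z ∈ circleIn Γ := by
  obtain ⟨c, hc⟩ := hΓ.exists_eq_smul_one (T := stdRep (p ^ k) z) (fun g => by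
    rw [← map_mul, ← map_mul, ← Subgroup.coe_mul, ← Subgroup.coe_mul, hz g])
  rw [Subgroup.mem_subgroupOf, Subgroup.mem_center_iff]
  refine fun g => stdRep_injective ?_
  change stdRep (p ^ k) (g * (z : U (p ^ k))) = stdRep (p ^ k) ((z : U (p ^ k)) * g)
  rw [map_mul, map_mul, hc, smul_mul_assoc, mul_smul_comm, one_mul, mul_one]

theorem finite_quotient : Finite (Γ ⧸ circleIn Γ) := by
  obtain ⟨e⟩ := hΓ.quotient
  have : NeZero p := ⟨(Fact.out : p.Prime).ne_zero⟩
  exact Finite.of_equiv _ e.symm.toEquiv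

omit [Fact p.Prime] in
theorem card_quotient : Nat.card (Γ ⧸ circleIn Γ) = p ^ k * p ^ k := by
  obtain ⟨e⟩ := hΓ.quotient
  rw [Nat.card_congr e.toEquiv, Nat.card_congr Multiplicative.toAdd, Nat.card_fun, Nat.card_zmod,
    Nat.card_fin, two_mul, pow_add]

theorem mul_comm_quotient (x y : Γ ⧸ circleIn Γ) : x * y = y * x := by
  obtain ⟨e⟩ := hΓ.quotient
  exact e.injective (by rw [map_mul, map_mul, mul_comm (e x)])

theorem exists_commForm_eq (x y : Γ ⧸ circleIn Γ) :
    ∃ c : ℂˣ, stdRep (p ^ k) (commForm Γ x y) = (c : ℂ) • 1 := by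
  refine hΓ.exists_eq_smul_one_of_mem_circleIn ?_
  induction x using QuotientGroup.induction_on with | _ g
  induction y using QuotientGroup.induction_on with | _ h
  rw [commForm_mk, ← QuotientGroup.eq_one_iff]
  have := hΓ.mul_comm_quotient (g : Γ ⧸ circleIn Γ) h
  rw [QuotientGroup.mk_mul, QuotientGroup.mk_mul, QuotientGroup.mk_mul, this,
    QuotientGroup.mk_inv, QuotientGroup.mk_inv, mul_inv_cancel_right, mul_inv_cancel]

/-- Commutators are scalars because the quotient is abelian; recording the scalar turns the form
into a bicharacter. Bimultiplicativity follows by moving one operator past a product in two steps,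
since a unitary operator is nonzero and so determines its scalar factor. -/
theorem exists_pairing : ∃ b : Γ ⧸ circleIn Γ →* Γ ⧸ circleIn Γ →* ℂˣ,
    (∀ g h : Γ, stdRep (p ^ k) g * stdRep (p ^ k) h =
      (b g h : ℂ) • (stdRep (p ^ k) h * stdRep (p ^ k) g)) ∧
    (∀ x y, b x y = 1 ↔ commForm Γ x y = 1) := by
  choose β hβ using hΓ.exists_commForm_eq
  have h1 : ∀ g h : Γ, stdRep (p ^ k) g * stdRep (p ^ k) h =
      (β g h : ℂ) • (stdRep (p ^ k) h * stdRep (p ^ k) g) := by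
    intro g h
    have e : (g : U (p ^ k)) * h = (commForm Γ g h : U (p ^ k)) * (h * g) := by
      have : g * h = commForm Γ g h * (h * g) := by rw [commForm_mk]; group
      exact congrArg Subtype.val this
    rw [← map_mul, e, map_mul, hβ, map_mul, smul_mul_assoc, one_mul]
  have hne : ∀ g : U (p ^ k), stdRep (p ^ k) g ≠ 0 := by
    have := nontrivial_space p k
    intro g hg
    obtain ⟨x, hx⟩ := exists_ne (0 : EuclideanSpace ℂ (Fin (p ^ k)))
    refine hx (stdRep_apply_injective g ?_)
    rw [hg, map_zero, LinearMap.zero_apply]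
  have huniq : ∀ (g : U (p ^ k)) (c d : ℂˣ),
      (c : ℂ) • stdRep (p ^ k) g = (d : ℂ) • stdRep (p ^ k) g → c = d := fun g c d h =>
    Units.ext (smul_left_injective ℂ (hne g) h)
  have hl : ∀ g g' h : Γ, β (g * g' : Γ) h = β g h * β g' h := by
    intro g g' h
    refine huniq (h * (g * g')) _ _ ?_
    have e := h1 (g * g') h
    rw [Subgroup.coe_mul, map_mul] at e
    rw [map_mul, map_mul, ← e, mul_assoc, h1 g' h, mul_smul_comm, ← mul_assoc, h1 g h,
      smul_mul_assoc, smul_smul, mul_assoc, Units.val_mul, mul_comm]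
  have hr : ∀ g h h' : Γ, β g (h * h' : Γ) = β g h * β g h' := by
    intro g h h'
    refine huniq ((h * h') * g) _ _ ?_
    have e := h1 g (h * h')
    rw [Subgroup.coe_mul, map_mul] at e
    rw [map_mul, map_mul, ← e, ← mul_assoc, h1 g h, smul_mul_assoc, mul_assoc, h1 g h',
      mul_smul_comm, smul_smul, ← mul_assoc, Units.val_mul]
  let b : Γ ⧸ circleIn Γ →* Γ ⧸ circleIn Γ →* ℂˣ :=
    MonoidHom.mk' (fun x => MonoidHom.mk' (β x) (fun y y' => by
      induction x using QuotientGroup.induction_on with | _ g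
      induction y using QuotientGroup.induction_on with | _ h
      induction y' using QuotientGroup.induction_on with | _ h'
      exact hr g h h')) (fun x x' => MonoidHom.ext fun y => by
      induction x using QuotientGroup.induction_on with | _ g
      induction x' using QuotientGroup.induction_on with | _ g'
      induction y using QuotientGroup.induction_on with | _ h
      exact hl g g' h)
  refine ⟨b, h1, fun x y => ⟨fun h => ?_, fun h => ?_⟩⟩
  · refine Subtype.ext (stdRep_injective ?_)
    have h' : β x y = 1 := h
    rw [hβ, h', Units.val_one, one_smul, Subgroup.coe_one, map_one]
  · refine huniq 1 _ _ ?_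
    change (β x y : ℂ) • stdRep (p ^ k) 1 = _
    rw [map_one, ← hβ, h, Subgroup.coe_one, map_one, Units.val_one, one_smul]

/-- The commutator form on `Γ / S¹` with values in `ℂˣ`. -/
noncomputable def pairing : Γ ⧸ circleIn Γ →* Γ ⧸ circleIn Γ →* ℂˣ := hΓ.exists_pairing.choose

theorem stdRep_mul_stdRep (g h : Γ) : stdRep (p ^ k) g * stdRep (p ^ k) h =
    (hΓ.pairing g h : ℂ) • (stdRep (p ^ k) h * stdRep (p ^ k) g) :=
  hΓ.exists_pairing.choose_spec.1 g h

theorem pairing_eq_one_iff (x y : Γ ⧸ circleIn Γ) : hΓ.pairing x y = 1 ↔ commForm Γ x y = 1 :=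
  hΓ.exists_pairing.choose_spec.2 x y

theorem pairing_mk_eq_one_iff (g h : Γ) : hΓ.pairing g h = 1 ↔ g * h = h * g := by
  rw [pairing_eq_one_iff, commForm_mk, mul_inv_eq_one, mul_inv_eq_iff_eq_mul]

theorem pairing_symm (x y : Γ ⧸ circleIn Γ) (h : hΓ.pairing x y = 1) : hΓ.pairing y x = 1 := by
  induction x using QuotientGroup.induction_on with | _ g
  induction y using QuotientGroup.induction_on with | _ g'
  rw [pairing_mk_eq_one_iff] at h ⊢
  exact h.symm

/-- Nondegeneracy: an element of the radical commutes with all of `Γ`, so is scalar by Schur's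
lemma. -/
theorem pairing_injective : Function.Injective hΓ.pairing := by
  refine (injective_iff_map_eq_one _).2 fun x hx => ?_
  induction x using QuotientGroup.induction_on with | _ g
  refine (QuotientGroup.eq_one_iff g).2 (hΓ.mem_circleIn_of_commute fun h => ?_)
  rw [← hΓ.pairing_mk_eq_one_iff, hx, MonoidHom.one_apply]

theorem coe_pairingPerp (W : Subgroup (Γ ⧸ circleIn Γ)) :
    (pairingPerp hΓ.pairing W : Set (Γ ⧸ circleIn Γ)) = perp W := by
  ext x
  exact forall₂_congr fun y _ => hΓ.pairing_eq_one_iff x y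

/-- Some `h` conjugates `g` to a multiple of itself by a scalar other than 1, while the trace is
invariant under conjugation. -/
theorem trace_stdRep_eq_zero {g : Γ} (hg : g ∉ circleIn Γ) :
    LinearMap.trace ℂ _ (stdRep (p ^ k) g) = 0 := by
  obtain ⟨h, hh⟩ : ∃ h : Γ, hΓ.pairing g h ≠ 1 := by
    by_contra! h
    exact hg (hΓ.mem_circleIn_of_commute fun x => (hΓ.pairing_mk_eq_one_iff g x).1 (h x))
  have h1 : stdRep (p ^ k) g = (hΓ.pairing g h : ℂ) •
      (stdRep (p ^ k) h * (stdRep (p ^ k) g * stdRep (p ^ k) (h : U (p ^ k))⁻¹)) := by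
    rw [← mul_assoc, ← smul_mul_assoc, ← hΓ.stdRep_mul_stdRep, mul_assoc, ← map_mul,
      mul_inv_cancel, map_one, mul_one]
  have h2 := congrArg (LinearMap.trace ℂ _) h1
  rw [map_smul, LinearMap.trace_mul_comm, mul_assoc, ← map_mul, inv_mul_cancel, map_one, mul_one,
    smul_eq_mul] at h2
  by_contra h0
  exact hh (Units.ext (mul_right_cancel₀ h0 (by rw [← h2, Units.val_one, one_mul])))

/-- Multiplying a relation by the inverse of one lift and taking the trace isolates its coefficient:
the other quotients are noncentral and have trace zero. -/
theorem linearIndependent_stdRep_out : LinearIndependent ℂ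
    fun q : Γ ⧸ circleIn Γ => stdRep (p ^ k) (q.out : Γ) := by
  classical
  have := hΓ.finite_quotient
  let _ : Fintype (Γ ⧸ circleIn Γ) := Fintype.ofFinite _
  refine Fintype.linearIndependent_iff.2 fun c hc q => ?_
  have h1 := congrArg (fun T => LinearMap.trace ℂ _
    (stdRep (p ^ k) ((q.out : Γ) : U (p ^ k))⁻¹ * T)) hc
  simp only [mul_zero, map_zero, Finset.mul_sum, map_sum, mul_smul_comm, map_smul] at h1
  rw [Finset.sum_eq_single q] at h1
  · rw [← map_mul, inv_mul_cancel, map_one, LinearMap.trace_one, finrank_euclideanSpace_fin,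
      smul_eq_mul] at h1
    refine (mul_eq_zero.1 h1).resolve_right ?_
    exact_mod_cast pow_ne_zero _ (Fact.out : p.Prime).ne_zero
  · intro r _ hr
    rw [← map_mul]
    have := hΓ.trace_stdRep_eq_zero (g := q.out⁻¹ * r.out) (fun h => hr ?_)
    · have e : stdRep (p ^ k) (((q.out : Γ) : U (p ^ k))⁻¹ * (r.out : Γ)) =
        stdRep (p ^ k) ((q.out⁻¹ * r.out : Γ) : U (p ^ k)) := rfl
      rw [e, this, smul_zero]
    · rw [← QuotientGroup.eq, QuotientGroup.out_eq', QuotientGroup.out_eq'] at h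
      exact h.symm
  · simp

theorem span_stdRep_out : Submodule.span ℂ
    (Set.range fun q : Γ ⧸ circleIn Γ => stdRep (p ^ k) (q.out : Γ)) = ⊤ := by
  have := hΓ.finite_quotient
  let _ : Fintype (Γ ⧸ circleIn Γ) := Fintype.ofFinite _
  refine hΓ.linearIndependent_stdRep_out.span_eq_top_of_card_eq_finrank' ?_
  rw [← Nat.card_eq_fintype_card, hΓ.card_quotient, Module.finrank_linearMap,
    finrank_euclideanSpace_fin]

/-- Expand an operator in the basis of lifts. Commutation with `h` forces each coefficient with
`pairing q h ≠ 1` to vanish, leaving only lifts of the complement of `W`. -/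
theorem commutant_le_span (W : Subgroup (Γ ⧸ circleIn Γ)) :
    commutant (W.comap (QuotientGroup.mk' (circleIn Γ))) ≤
      Submodule.span ℂ (Set.range fun q : pairingPerp hΓ.pairing W =>
        stdRep (p ^ k) (q.1.out : Γ)) := by
  classical
  have := hΓ.finite_quotient
  let _ : Fintype (Γ ⧸ circleIn Γ) := Fintype.ofFinite _
  intro T hT
  obtain ⟨c, rfl⟩ := (Submodule.mem_span_range_iff_exists_fun ℂ).1
    (hΓ.span_stdRep_out ▸ Submodule.mem_top (x := T))
  refine Submodule.sum_mem _ fun q _ => ?_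
  by_cases hq : c q = 0
  · rw [hq, zero_smul]
    exact Submodule.zero_mem _
  refine Submodule.smul_mem _ _ (Submodule.subset_span ⟨⟨q, fun y hy => ?_⟩, rfl⟩)
  obtain ⟨h, rfl⟩ := QuotientGroup.mk_surjective y
  have h1 := hT h hy
  have h2 : stdRep (p ^ k) h * ∑ q : Γ ⧸ circleIn Γ,
      (c q * (hΓ.pairing q h - 1)) • stdRep (p ^ k) (q.out : Γ) = 0 := by
    rw [← sub_eq_zero, Finset.sum_mul, Finset.mul_sum, ← Finset.sum_sub_distrib] at h1
    rw [Finset.mul_sum, ← h1]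
    refine Finset.sum_congr rfl fun r _ => ?_
    have := hΓ.stdRep_mul_stdRep r.out h
    rw [QuotientGroup.out_eq'] at this
    rw [smul_mul_assoc, this, mul_smul_comm, mul_smul_comm, smul_smul, ← sub_smul]
    congr 1
    ring
  have h3 : ∑ q : Γ ⧸ circleIn Γ,
      (c q * (hΓ.pairing q h - 1)) • stdRep (p ^ k) (q.out : Γ) = 0 := by
    have := congrArg (fun S => stdRep (p ^ k) (h : U (p ^ k))⁻¹ * S) h2
    rwa [← mul_assoc, ← map_mul, inv_mul_cancel, map_one, one_mul, mul_zero] at this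
  have h4 := Fintype.linearIndependent_iff.1 hΓ.linearIndependent_stdRep_out _ h3 q
  refine Units.ext (sub_eq_zero.1 ((mul_eq_zero.1 h4).resolve_left hq))

theorem finrank_commutant_le (W : Subgroup (Γ ⧸ circleIn Γ)) :
    Module.finrank ℂ (commutant (W.comap (QuotientGroup.mk' (circleIn Γ)))) ≤ W.index := by
  have := hΓ.finite_quotient
  let _ : Fintype (pairingPerp hΓ.pairing W) := Fintype.ofFinite _
  rw [← card_pairingPerp hΓ.mul_comm_quotient hΓ.pairing_injective W, Nat.card_eq_fintype_card]
  exact (Submodule.finrank_mono (hΓ.commutant_le_span W)).trans (finrank_range_le_card _)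

end IsGammaSubgroup

/-! ### Recognizing isotypical decompositions -/

/-- Each member of `C` is a simple submodule stable under all endomorphisms, hence an isotypic
component. Since `C` spans, independence of isotypic components leaves no room for another. -/
theorem Representation.image_isotypicComponents_eq {K G V : Type*} [Field K] [Monoid G]
    [AddCommGroup V] [Module K V] (ρ : Representation K G V) (C : Set (Submodule K V))
    (hbot : ∀ v ∈ C, v ≠ ⊥) (htop : sSup C = ⊤) (hinv : ∀ v ∈ C, ∀ g, ∀ x ∈ v, ρ g x ∈ v)
    (hirr : ∀ v ∈ C, ∀ u ≤ v, (∀ g, ∀ x ∈ u, ρ g x ∈ u) → u = ⊥ ∨ u = v)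
    (hcomm : ∀ v ∈ C, ∀ T : Module.End K V, (∀ g, T * ρ g = ρ g * T) → ∀ x ∈ v, T x ∈ v) :
    (fun N => (N.restrictScalars K).map (ρ.asModuleEquiv : ρ.asModule →ₗ[K] V)) ''
      isotypicComponents K[G] ρ.asModule = C := by
  let N : C → Submodule K[G] ρ.asModule := fun v =>
    Subrepresentation.asSubmodule ⟨v.1, fun g x hx => hinv v.1 v.2 g x hx⟩
  have hmap : ∀ v, ((N v).restrictScalars K).map (ρ.asModuleEquiv : ρ.asModule →ₗ[K] V) = v.1 :=
    fun v => Submodule.map_id _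
  have hsimple : ∀ v, IsSimpleModule K[G] (N v) := fun v => by
    rw [isSimpleModule_iff_isAtom]
    refine ⟨fun h => hbot v.1 v.2 ?_, fun N' hN' => ?_⟩
    · exact (Submodule.eq_bot_iff _).2 fun x hx => (Submodule.eq_bot_iff _).1 h x hx
    · let u := Subrepresentation.ofSubmodule' N'
      rcases hirr v.1 v.2 u.toSubmodule hN'.le (fun g x hx => u.apply_mem_toSubmodule g hx)
        with h | h
      · exact (Submodule.eq_bot_iff _).2 fun x hx => (Submodule.eq_bot_iff _).1 h x hx
      · exact absurd (fun x hx => h.ge hx : N v ≤ N') hN'.not_ge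
  have hle : ∀ M : Submodule K[G] ρ.asModule, (∀ v, N v ≤ M) → M = ⊤ := fun M hM => by
    have h : sSup C ≤ (Subrepresentation.ofSubmodule' M).toSubmodule :=
      sSup_le fun v hv => hM ⟨v, hv⟩
    rw [htop] at h
    exact top_le_iff.1 fun x _ => h (Submodule.mem_top (x := x))
  have hss : IsSemisimpleModule K[G] ρ.asModule :=
    .of_sSup_simples_eq_top (hle _ fun v => le_sSup (hsimple v))
  have hmem : ∀ v, N v ∈ isotypicComponents K[G] ρ.asModule := fun v => by
    refine mem_isotypicComponents_iff.2 ⟨?_, fun f x hx => ?_, fun h => ?_⟩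
    · exact (@IsIsotypicOfType.of_isSimpleModule K[G] (N v) _ _ _ (hsimple v)).isIsotypic
    · let T : Module.End K V := ρ.asModuleEquiv.toLinearMap ∘ₗ f.restrictScalars K ∘ₗ
        ρ.asModuleEquiv.symm.toLinearMap
      refine hcomm v.1 v.2 T (fun g => LinearMap.ext fun y => ?_) x hx
      have := f.map_smul (MonoidAlgebra.single g (1 : K)) (ρ.asModuleEquiv.symm y)
      rw [Representation.single_smul, Representation.single_smul, one_smul, one_smul] at this
      exact this
    · have := (hsimple v).nontrivial
      exact (Submodule.nontrivial_iff_ne_bot.1 this) h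
  apply Set.Subset.antisymm
  · rintro _ ⟨M, hM, rfl⟩
    by_contra hne
    have hsup : sSup (isotypicComponents K[G] ρ.asModule \ {M}) = ⊤ := by
      refine hle _ fun v => le_sSup ⟨hmem v, ?_⟩
      rintro rfl
      exact hne (Set.mem_of_eq_of_mem (hmap v) v.2)
    have := sSupIndep_isotypicComponents K[G] ρ.asModule hM
    rw [hsup, disjoint_top] at this
    exact (bot_lt_isotypicComponents hM).ne' this
  · intro v hv
    exact ⟨N ⟨v, hv⟩, hmem _, hmap _⟩

/-! ### Isotropy groups -/

/-- The hypothesis says that conjugation by `g` changes `h` only by an element fixing `x`. It is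
used with scalars, which fix every subspace. -/
theorem smul_smul_eq_smul_iff {G X : Type*} [Group G] [MulAction G X] {g h : G} {x : X}
    (hx : (h⁻¹ * (g⁻¹ * h * g)) • x = x) : h • g • x = g • x ↔ h • x = x := by
  have h2 : h • g • x = g • h • x := by
    conv_rhs => rw [← hx]
    simp only [smul_smul]
    congr 1
    group
  rw [h2, smul_left_cancel_iff]

section Isotropy

variable {n : ℕ} {Γ : Subgroup (U n)}

theorem mem_isotropy {v : Submodule ℂ (EuclideanSpace ℂ (Fin n))} {g : Γ} :
    g ∈ isotropy Γ v ↔ (g : U n) • v = v := Iff.rfl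

namespace FixedDecomp

theorem smul_mem_classes (a : FixedDecomp Γ) {v : Submodule ℂ (EuclideanSpace ℂ (Fin n))}
    (hv : v ∈ a.1.classes) (g : Γ) : (g : U n) • v ∈ a.1.classes := by
  have h : (g : U n) • v ∈ ((g : U n) • a.1).classes := ⟨v, hv, rfl⟩
  rwa [a.2 g g.2] at h

end FixedDecomp

end Isotropy

/-! ### Orthogonal projections onto the components -/

namespace OrthDecomp

variable {n : ℕ} (a : OrthDecomp n)

theorem exists_mem_classes [Nontrivial (EuclideanSpace ℂ (Fin n))] : ∃ v, v ∈ a.classes := by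
  by_contra! h
  have h1 : a.classes = ∅ := Set.eq_empty_of_forall_notMem h
  have h2 := a.sSup_eq_top
  rw [h1, sSup_empty] at h2
  exact bot_ne_top h2

theorem eq_zero_of_starProjection_eq_zero {x : EuclideanSpace ℂ (Fin n)}
    (hx : ∀ w ∈ a.classes, w.starProjection x = 0) : x = 0 := by
  have h1 : sSup a.classes ≤ (Submodule.span ℂ {x})ᗮ := by
    refine sSup_le fun w hw => ?_
    rw [Submodule.le_orthogonal_iff_le_orthogonal, Submodule.span_singleton_le_iff_mem]
    exact (Submodule.starProjection_apply_eq_zero_iff w).1 (hx w hw)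
  rw [a.sSup_eq_top, top_le_iff, Submodule.orthogonal_eq_top_iff] at h1
  exact Submodule.span_singleton_eq_bot.1 h1

theorem starProjection_apply_of_ne {v w : Submodule ℂ (EuclideanSpace ℂ (Fin n))}
    (hv : v ∈ a.classes) (hw : w ∈ a.classes) (hvw : v ≠ w) {x : EuclideanSpace ℂ (Fin n)}
    (hx : x ∈ v) : w.starProjection x = 0 :=
  (Submodule.starProjection_apply_eq_zero_iff w).2 (a.orthogonal v hv w hw hvw hx)

theorem sum_smul_starProjection_apply [Fintype a.classes] (c : a.classes → ℂ) (v : a.classes)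
    {x : EuclideanSpace ℂ (Fin n)} (hx : x ∈ v.1) :
    (∑ w, c w • (w.1.starProjection : Module.End ℂ (EuclideanSpace ℂ (Fin n)))) x = c v • x := by
  rw [LinearMap.sum_apply, Finset.sum_eq_single v]
  · rw [LinearMap.smul_apply, ContinuousLinearMap.coe_coe,
      Submodule.starProjection_eq_self_iff.2 hx]
  · intro w _ hw
    rw [LinearMap.smul_apply, ContinuousLinearMap.coe_coe,
      a.starProjection_apply_of_ne v.2 w.2 (fun h => hw (Subtype.ext h.symm)) hx, smul_zero]
  · exact fun h => absurd (Finset.mem_univ v) h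

theorem linearIndependent_starProjection [Fintype a.classes] : LinearIndependent ℂ
    fun w : a.classes => (w.1.starProjection : Module.End ℂ (EuclideanSpace ℂ (Fin n))) := by
  refine Fintype.linearIndependent_iff.2 fun c hc v => ?_
  obtain ⟨x, hx, hx0⟩ := Submodule.exists_mem_ne_zero_of_ne_bot (a.ne_bot v.1 v.2)
  have h := a.sum_smul_starProjection_apply c v hx
  rw [hc, LinearMap.zero_apply] at h
  exact (smul_eq_zero.1 h.symm).resolve_right hx0

end OrthDecomp

/-! ### Fixed decompositions and the commutant of their isotropy group -/

namespace IsGammaSubgroup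

variable {p k : ℕ} [Fact p.Prime] {Γ : Subgroup (U (p ^ k))} (hΓ : IsGammaSubgroup p k Γ)

include hΓ

theorem circleIn_le_isotropy (v : Submodule ℂ (EuclideanSpace ℂ (Fin (p ^ k)))) :
    circleIn Γ ≤ isotropy Γ v := by
  intro z hz
  obtain ⟨c, hc⟩ := hΓ.exists_eq_smul_one_of_mem_circleIn hz
  refine smul_eq_self_of_le (smul_submodule_le_iff.2 fun x hx => ?_)
  rw [Subgroup.subtype_apply, hc]
  exact v.smul_mem _ hx

theorem comap_map_isotropy (v : Submodule ℂ (EuclideanSpace ℂ (Fin (p ^ k)))) :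
    ((isotropy Γ v).map (QuotientGroup.mk' (circleIn Γ))).comap (QuotientGroup.mk' (circleIn Γ)) =
      isotropy Γ v :=
  Subgroup.comap_map_eq_self (by
    rw [QuotientGroup.ker_mk']
    exact hΓ.circleIn_le_isotropy v)

theorem isotropy_smul (g : Γ) (v : Submodule ℂ (EuclideanSpace ℂ (Fin (p ^ k)))) :
    isotropy Γ ((g : U (p ^ k)) • v) = isotropy Γ v := by
  ext h
  have hz : h⁻¹ * (g⁻¹ * h * g) ∈ circleIn Γ := by
    rw [← QuotientGroup.eq, QuotientGroup.mk_mul, QuotientGroup.mk_mul, hΓ.mul_comm_quotient,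
      QuotientGroup.mk_inv, mul_inv_cancel_left]
  have h1 := mem_isotropy.1 (hΓ.circleIn_le_isotropy v hz)
  simp only [Subgroup.coe_mul, Subgroup.coe_inv] at h1
  exact smul_smul_eq_smul_iff h1

-- The translates of `v` span an invariant subspace, hence everything. A component outside the orbit
-- of `v` would be orthogonal to all of them, so zero.
omit [Fact p.Prime] in
theorem exists_smul_eq (a : FixedDecomp Γ) {v w : Submodule ℂ (EuclideanSpace ℂ (Fin (p ^ k)))}
    (hv : v ∈ a.1.classes) (hw : w ∈ a.1.classes) : ∃ g : Γ, (g : U (p ^ k)) • v = w := by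
  by_contra! hne
  have hM : (⨆ g : Γ, (g : U (p ^ k)) • v) = ⊥ ∨ (⨆ g : Γ, (g : U (p ^ k)) • v) = ⊤ := by
    refine hΓ.eq_bot_or_eq_top fun h => ?_
    rw [smul_submodule_def, Submodule.map_iSup]
    refine iSup_le fun g => ?_
    rw [← smul_submodule_def, smul_smul]
    exact le_iSup (fun g : Γ => (g : U (p ^ k)) • v) (h * g)
  rcases hM with h | h
  · refine a.1.ne_bot v hv (le_bot_iff.1 (h ▸ ?_))
    have := le_iSup (fun g : Γ => (g : U (p ^ k)) • v) 1
    rwa [Subgroup.coe_one, one_smul] at this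
  · refine a.1.ne_bot w hw ?_
    rw [← Submodule.isOrtho_top_right, ← h, Submodule.isOrtho_iSup_right]
    exact fun g => a.1.orthogonal w hw _ (a.smul_mem_classes hv g) (hne g).symm

theorem isotropy_eq (a : FixedDecomp Γ) {v w : Submodule ℂ (EuclideanSpace ℂ (Fin (p ^ k)))}
    (hv : v ∈ a.1.classes) (hw : w ∈ a.1.classes) : isotropy Γ v = isotropy Γ w := by
  obtain ⟨g, rfl⟩ := hΓ.exists_smul_eq a hv hw
  exact (hΓ.isotropy_smul g v).symm

omit [Fact p.Prime] in
theorem card_classes (a : FixedDecomp Γ) {v : Submodule ℂ (EuclideanSpace ℂ (Fin (p ^ k)))}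
    (hv : v ∈ a.1.classes) : Nat.card a.1.classes = (isotropy Γ v).index := by
  have h1 : isotropy Γ v = MulAction.stabilizer Γ v := rfl
  have h2 : a.1.classes = MulAction.orbit Γ v := by
    ext w
    exact ⟨fun hw => hΓ.exists_smul_eq a hv hw, by
      rintro ⟨g, rfl⟩
      exact a.smul_mem_classes hv g⟩
  rw [h1, MulAction.index_stabilizer, ← h2, Nat.card_coe_set_eq]

/-- Operators commuting with the isotropy group act as scalars on the components. -/
theorem exists_apply_eq_smul (a : FixedDecomp Γ)
    {v : Submodule ℂ (EuclideanSpace ℂ (Fin (p ^ k)))} (hv : v ∈ a.1.classes)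
    {T : Module.End ℂ (EuclideanSpace ℂ (Fin (p ^ k)))} (hT : T ∈ commutant (isotropy Γ v)) :
    ∃ c : ℂ, ∀ x ∈ v, T x = c • x := by
  let _ : Fintype a.1.classes := a.1.finite_classes.fintype
  let P : a.1.classes → Module.End ℂ (EuclideanSpace ℂ (Fin (p ^ k))) :=
    fun w => (w.1.starProjection : Module.End ℂ (EuclideanSpace ℂ (Fin (p ^ k))))
  have hP : Submodule.span ℂ (Set.range P) ≤ commutant (isotropy Γ v) := by
    rw [Submodule.span_le]
    rintro _ ⟨w, rfl⟩
    refine starProjection_mem_commutant fun g hg => ?_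
    rw [hΓ.isotropy_eq a hv w.2] at hg
    exact hg
  -- The projections are independent and number `(isotropy Γ v).index`, exactly the upper bound for
  -- the commutant; so they span it.
  have hfin : Module.finrank ℂ (commutant (isotropy Γ v)) ≤
      Module.finrank ℂ (Submodule.span ℂ (Set.range P)) := by
    rw [finrank_span_eq_card a.1.linearIndependent_starProjection, ← Nat.card_eq_fintype_card,
      hΓ.card_classes a hv, ← hΓ.comap_map_isotropy v,
      Subgroup.index_comap_of_surjective _ (QuotientGroup.mk'_surjective _)]
    exact hΓ.finrank_commutant_le _
  rw [← Submodule.eq_of_le_of_finrank_le hP hfin] at hT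
  obtain ⟨c, rfl⟩ := (Submodule.mem_span_range_iff_exists_fun ℂ).1 hT
  exact ⟨c ⟨v, hv⟩, fun x hx => a.1.sum_smul_starProjection_apply c ⟨v, hv⟩ hx⟩

/-- An element orthogonal to the image of the isotropy group commutes with that group, so acts on
`v` by a scalar and preserves it. -/
theorem isCoisotropic_isotropy (a : FixedDecomp Γ)
    {v : Submodule ℂ (EuclideanSpace ℂ (Fin (p ^ k)))} (hv : v ∈ a.1.classes) :
    IsCoisotropic (isotropy Γ v) := by
  refine ⟨(isotropy Γ v).map (QuotientGroup.mk' (circleIn Γ)), fun x hx => ?_,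
    (hΓ.comap_map_isotropy v).symm⟩
  obtain ⟨g, rfl⟩ := QuotientGroup.mk_surjective x
  have hT : stdRep (p ^ k) g ∈ commutant (isotropy Γ v) := fun h hh => by
    have h1 := (hΓ.pairing_eq_one_iff _ _).2 (hx (QuotientGroup.mk' (circleIn Γ) h)
      (Subgroup.mem_map_of_mem _ hh))
    have h2 := (hΓ.pairing_mk_eq_one_iff g h).1 h1
    rw [← map_mul, ← map_mul, ← Subgroup.coe_mul, h2, Subgroup.coe_mul]
  obtain ⟨c, hc⟩ := hΓ.exists_apply_eq_smul a hv hT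
  refine Subgroup.mem_map_of_mem (QuotientGroup.mk' (circleIn Γ)) (x := g) ?_
  refine smul_eq_self_of_le (smul_submodule_le_iff.2 fun x hx => ?_)
  rw [Subgroup.subtype_apply, hc x hx]
  exact v.smul_mem c hx

omit [Fact p.Prime] in
theorem isotropy_ne_top (a : FixedDecomp Γ)
    {v : Submodule ℂ (EuclideanSpace ℂ (Fin (p ^ k)))} (hv : v ∈ a.1.classes) :
    isotropy Γ v ≠ ⊤ := by
  intro h
  have hinv : ∀ g : Γ, (g : U (p ^ k)) • v ≤ v := fun g =>
    (mem_isotropy.1 (h ▸ Subgroup.mem_top g)).le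
  exact (hΓ.eq_bot_or_eq_top hinv).elim (a.1.ne_bot v hv) (a.1.ne_top v hv)

/-- The projection onto the invariant subspace `u` acts on `v` by a scalar: if it is zero then `u`
is zero, otherwise `v ≤ u`. -/
theorem eq_bot_or_eq_of_le (a : FixedDecomp Γ)
    {u v : Submodule ℂ (EuclideanSpace ℂ (Fin (p ^ k)))} (hv : v ∈ a.1.classes) (huv : u ≤ v)
    (hu : ∀ g ∈ isotropy Γ v, (g : U (p ^ k)) • u ≤ u) : u = ⊥ ∨ u = v := by
  obtain ⟨c, hc⟩ := hΓ.exists_apply_eq_smul a hv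
    (starProjection_mem_commutant fun g hg => smul_eq_self_of_le (hu g hg))
  by_cases h0 : c = 0
  · refine Or.inl ((Submodule.eq_bot_iff _).2 fun x hx => ?_)
    have := hc x (huv hx)
    rwa [h0, zero_smul, ContinuousLinearMap.coe_coe,
      Submodule.starProjection_eq_self_iff.2 hx] at this
  · refine Or.inr (le_antisymm huv fun x hx => ?_)
    have := u.starProjection_apply_mem x
    rw [← ContinuousLinearMap.coe_coe, hc x hx] at this
    exact (u.smul_mem_iff h0).1 this

theorem isotypicalSummands_isotropy (a : FixedDecomp Γ)
    {v : Submodule ℂ (EuclideanSpace ℂ (Fin (p ^ k)))} (hv : v ∈ a.1.classes) :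
    isotypicalSummands (isotropy Γ v) = a.1.classes := by
  refine Representation.image_isotypicComponents_eq _ _ a.1.ne_bot a.1.sSup_eq_top
    (fun w hw g x hx => ?_) (fun w hw u huw hu => ?_) (fun w hw T hT x hx => ?_)
  · have hg : (g : Γ) ∈ isotropy Γ w := hΓ.isotropy_eq a hv hw ▸ g.2
    exact (mem_isotropy.1 hg).le (mem_smul_submodule hx)
  · refine hΓ.eq_bot_or_eq_of_le a hw huw fun g hg => smul_submodule_le_iff.2 fun x hx => ?_
    rw [← hΓ.isotropy_eq a hv hw] at hg
    exact hu ⟨g, hg⟩ x hx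
  · obtain ⟨c, hc⟩ := hΓ.exists_apply_eq_smul a hw (T := T) (fun g hg => by
      rw [← hΓ.isotropy_eq a hv hw] at hg
      exact hT ⟨g, hg⟩)
    rw [hc x hx]
    exact w.smul_mem c hx

/-- If `v` lies in a component of `b`, an element preserving `v` cannot move that component to an
orthogonal one. Conversely, projections onto components of `b` commute with the isotropy of `a`, so
act by scalars on each component of `a`; some scalar is nonzero, which forces containment. -/
theorem le_iff_isotropy_le (a b : FixedDecomp Γ)
    {v w : Submodule ℂ (EuclideanSpace ℂ (Fin (p ^ k)))} (hv : v ∈ a.1.classes)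
    (hw : w ∈ b.1.classes) : a ≤ b ↔ isotropy Γ v ≤ isotropy Γ w := by
  constructor
  · intro hab g hg
    obtain ⟨w', hw', hle⟩ := hab v hv
    rw [hΓ.isotropy_eq b hw hw', mem_isotropy]
    by_contra hne
    have h1 := b.1.orthogonal _ (b.smul_mem_classes hw' g) w' hw' hne
    have h2 : v ≤ (g : U (p ^ k)) • w' := by
      rw [← mem_isotropy.1 hg]
      exact Submodule.map_mono hle
    exact a.1.ne_bot v hv (Submodule.isOrtho_self.1 (h1.mono h2 hle))
  · intro h v' hv'
    rw [hΓ.isotropy_eq a hv hv'] at h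
    obtain ⟨x, hx, hx0⟩ := Submodule.exists_mem_ne_zero_of_ne_bot (a.1.ne_bot v' hv')
    obtain ⟨w', hw', hne⟩ : ∃ w' ∈ b.1.classes, w'.starProjection x ≠ 0 := by
      by_contra! h0
      exact hx0 (b.1.eq_zero_of_starProjection_eq_zero h0)
    obtain ⟨c, hc⟩ := hΓ.exists_apply_eq_smul a hv' (starProjection_mem_commutant (w := w')
      fun g hg => mem_isotropy.1 (hΓ.isotropy_eq b hw hw' ▸ h hg))
    have hc0 : c ≠ 0 := by
      rintro rfl
      exact hne ((hc x hx).trans (zero_smul _ _))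
    refine ⟨w', hw', fun y hy => (w'.smul_mem_iff hc0).1 ?_⟩
    rw [← hc y hy]
    exact w'.starProjection_apply_mem y

end IsGammaSubgroup

/-! ### Joint eigenspaces -/

section JointEigenspace

variable {n : ℕ} {Γ : Subgroup (U n)}

/-- The joint eigenspace of a subgroup `A` of `Γ ≤ U(n)` with eigenvalues `χ`. -/
noncomputable def jointEigenspace (A : Subgroup Γ) (χ : A → ℂ) :
    Submodule ℂ (EuclideanSpace ℂ (Fin n)) :=
  ⨅ a : A, Module.End.eigenspace (stdRep n (a : Γ)) (χ a)

theorem mem_jointEigenspace {A : Subgroup Γ} {χ : A → ℂ} {x : EuclideanSpace ℂ (Fin n)} :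
    x ∈ jointEigenspace A χ ↔ ∀ a : A, stdRep n (a : Γ) x = χ a • x := by
  simp only [jointEigenspace, Submodule.mem_iInf, Module.End.mem_eigenspace_iff]

theorem eq_of_jointEigenspace_eq {A : Subgroup Γ} {χ ψ : A → ℂ}
    (h : jointEigenspace A χ = jointEigenspace A ψ) (hχ : jointEigenspace A χ ≠ ⊥) : χ = ψ := by
  obtain ⟨x, hx, hx0⟩ := Submodule.exists_mem_ne_zero_of_ne_bot hχ
  funext a
  have h1 := mem_jointEigenspace.1 hx a
  rw [mem_jointEigenspace.1 (h ▸ hx) a] at h1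
  exact (smul_left_injective ℂ hx0 h1).symm

theorem isOrtho_jointEigenspace {A : Subgroup Γ} {χ ψ : A → ℂ} (h : χ ≠ ψ) :
    jointEigenspace A χ ⟂ jointEigenspace A ψ := by
  rw [Submodule.isOrtho_iff_inner_eq]
  intro x hx y hy
  obtain ⟨a, ha⟩ := Function.ne_iff.1 h
  by_cases hx0 : x = 0
  · rw [hx0, inner_zero_left]
  have h1 := stdRep_inner ((a : Γ) : U n) x x
  have h2 := stdRep_inner ((a : Γ) : U n) x y
  rw [mem_jointEigenspace.1 hx a, inner_smul_left, inner_smul_right, ← mul_assoc] at h1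
  rw [mem_jointEigenspace.1 hx a, mem_jointEigenspace.1 hy a, inner_smul_left, inner_smul_right,
    ← mul_assoc] at h2
  -- Unitarity gives `conj (χ a) * χ a = 1`; a nonzero inner product would also give `conj (χ a) * ψ
  -- a = 1`, contradicting `χ a ≠ ψ a`.
  have h3 := mul_eq_right₀ (inner_self_ne_zero.2 hx0) |>.1 h1
  by_contra h0
  have h4 := mul_eq_right₀ h0 |>.1 h2
  exact ha (mul_left_cancel₀ (left_ne_zero_of_mul_eq_one h3) (h3.trans h4.symm))

/-- A commuting family of operators has a joint eigenvector. -/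
theorem exists_jointEigenspace_ne_bot [Nontrivial (EuclideanSpace ℂ (Fin n))] {A : Subgroup Γ}
    (hA : ∀ a ∈ A, ∀ b ∈ A, a * b = b * a) : ∃ χ, jointEigenspace A χ ≠ ⊥ := by
  -- On a minimal nonzero invariant subspace each operator is a scalar: its eigenspace there is
  -- invariant by commutativity, hence everything.
  obtain ⟨M, ⟨hM0, hM⟩, hmin⟩ := exists_minimal_of_wellFoundedLT
    (fun M : Submodule ℂ (EuclideanSpace ℂ (Fin n)) =>
      M ≠ ⊥ ∧ ∀ a : A, ∀ x ∈ M, stdRep n (a : Γ) x ∈ M)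
    ⟨⊤, top_ne_bot, fun _ _ _ => Submodule.mem_top⟩
  have : Nontrivial M := Submodule.nontrivial_iff_ne_bot.2 hM0
  have key : ∀ a : A, ∃ c : ℂ, M ≤ Module.End.eigenspace (stdRep n (a : Γ)) c := by
    intro a
    obtain ⟨c, hc⟩ := Module.End.exists_eigenvalue ((stdRep n (a : Γ)).restrict (hM a))
    obtain ⟨y, hy, hy0⟩ := hc.exists_hasEigenvector
    have hy' := congrArg Subtype.val (Module.End.mem_eigenspace_iff.1 hy)
    refine ⟨c, (hmin (y := M ⊓ Module.End.eigenspace (stdRep n (a : Γ)) c) ⟨fun h => ?_,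
      fun b x hx => ⟨hM b x hx.1, ?_⟩⟩ inf_le_left).trans inf_le_right⟩
    · have h1 : (y : EuclideanSpace ℂ (Fin n)) ∈
          M ⊓ Module.End.eigenspace (stdRep n (a : Γ)) c :=
        ⟨y.2, Module.End.mem_eigenspace_iff.2 hy'⟩
      rw [h, Submodule.mem_bot] at h1
      exact hy0 (Subtype.ext h1)
    · have h1 := Module.End.mem_eigenspace_iff.1 hx.2
      refine Module.End.mem_eigenspace_iff.2 ?_
      have e : stdRep n (a : Γ) * stdRep n (b : Γ) = stdRep n (b : Γ) * stdRep n (a : Γ) := by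
        rw [← map_mul, ← map_mul, ← Subgroup.coe_mul, hA a a.2 b b.2, Subgroup.coe_mul]
      rw [← Module.End.mul_apply, e, Module.End.mul_apply, h1, map_smul]
  choose χ hχ using key
  exact ⟨χ, fun h => hM0 (le_bot_iff.1 (h ▸ le_iInf hχ))⟩

end JointEigenspace

/-! ### From coisotropic subgroups to decompositions -/

namespace IsGammaSubgroup

variable {p k : ℕ} [Fact p.Prime] {Γ : Subgroup (U (p ^ k))} (hΓ : IsGammaSubgroup p k Γ)

include hΓ

/-- Moving `a` past `g` costs the scalar `pairing a g`, so `Γ` permutes the joint eigenspaces by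
twisting their eigenvalues. -/
theorem smul_jointEigenspace (g : Γ) (A : Subgroup Γ) (χ : A → ℂ) :
    (g : U (p ^ k)) • jointEigenspace A χ =
      jointEigenspace A fun a => hΓ.pairing (a : Γ) g * χ a := by
  have hle : ∀ (g : Γ) (χ : A → ℂ), (g : U (p ^ k)) • jointEigenspace A χ ≤
      jointEigenspace A fun a => hΓ.pairing (a : Γ) g * χ a := by
    refine fun g χ => smul_submodule_le_iff.2 fun x hx => mem_jointEigenspace.2 fun a => ?_
    have := LinearMap.congr_fun (hΓ.stdRep_mul_stdRep a g) x
    rw [Module.End.mul_apply, LinearMap.smul_apply, Module.End.mul_apply,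
      mem_jointEigenspace.1 hx a, map_smul, smul_smul] at this
    exact this
  refine le_antisymm (hle g χ) ?_
  have h1 := hle g⁻¹ (fun a => hΓ.pairing (a : Γ) g * χ a)
  have h2 : (fun a : A => (hΓ.pairing (a : Γ) (g⁻¹ : Γ) : ℂ) * (hΓ.pairing (a : Γ) g * χ a)) =
      χ := by
    funext a
    rw [← mul_assoc, ← Units.val_mul, ← map_mul, ← QuotientGroup.mk_mul, inv_mul_cancel,
      QuotientGroup.mk_one, map_one, Units.val_one, one_mul]
  rw [h2, Subgroup.coe_inv] at h1
  have h3 : (g : U (p ^ k)) • (g : U (p ^ k))⁻¹ •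
      (jointEigenspace A fun a => hΓ.pairing (a : Γ) g * χ a) ≤
      (g : U (p ^ k)) • jointEigenspace A χ := Submodule.map_mono h1
  rwa [smul_inv_smul] at h3

/-- Every proper coisotropic subgroup is the isotropy group of a fixed decomposition. -/
theorem exists_isotropy_eq {H : Subgroup Γ} (hH : IsCoisotropic H) (hne : H ≠ ⊤) :
    ∃ a : FixedDecomp Γ, ∀ v ∈ a.1.classes, isotropy Γ v = H := by
  have := nontrivial_space p k
  have := hΓ.finite_quotient
  obtain ⟨W, hW, rfl⟩ := hH
  -- Coisotropy says that `W` contains its complement, so the preimage `A` of the complement is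
  -- abelian.
  let A : Subgroup Γ := (pairingPerp hΓ.pairing W).comap (QuotientGroup.mk' (circleIn Γ))
  have hA : ∀ a ∈ A, ∀ b ∈ A, a * b = b * a := fun a ha b hb => by
    rw [← hΓ.coe_pairingPerp] at hW
    exact (hΓ.pairing_mk_eq_one_iff a b).1 (ha b (hW hb))
  have hiso : ∀ χ : A → ℂ, jointEigenspace A χ ≠ ⊥ →
      isotropy Γ (jointEigenspace A χ) = W.comap (QuotientGroup.mk' (circleIn Γ)) := by
    intro χ hχ
    ext g
    rw [mem_isotropy, hΓ.smul_jointEigenspace, Subgroup.mem_comap]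
    have hχ0 : ∀ a : A, χ a ≠ 0 := by
      intro a h0
      obtain ⟨x, hx, hx0⟩ := Submodule.exists_mem_ne_zero_of_ne_bot hχ
      have h1 := mem_jointEigenspace.1 hx a
      rw [h0, zero_smul] at h1
      exact hx0 (stdRep_apply_injective _ (h1.trans (map_zero _).symm))
    -- A nonzero eigenspace is preserved by `g` exactly when the twist by `g` is trivial on `A`,
    -- that is, when `g` lies over the double complement of `W`.
    rw [← pairingPerp_pairingPerp hΓ.mul_comm_quotient hΓ.pairing_injective hΓ.pairing_symm W]
    constructor
    · intro h y hy
      obtain ⟨a, rfl⟩ := QuotientGroup.mk_surjective y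
      refine hΓ.pairing_symm _ _ (Units.ext ?_)
      exact mul_eq_right₀ (hχ0 ⟨a, hy⟩) |>.1
        (congrFun (eq_of_jointEigenspace_eq h.symm hχ) ⟨a, hy⟩).symm
    · intro h
      congr 1
      funext a
      have e : hΓ.pairing (a : Γ) g = 1 := hΓ.pairing_symm _ _ (h _ a.2)
      rw [e, Units.val_one, one_mul]
  have hsmul : ∀ (g : Γ) (v : Submodule ℂ (EuclideanSpace ℂ (Fin (p ^ k)))),
      (v ≠ ⊥ ∧ ∃ χ : A → ℂ, v = jointEigenspace A χ) → ((g : U (p ^ k)) • v ≠ ⊥ ∧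
        ∃ χ : A → ℂ, (g : U (p ^ k)) • v = jointEigenspace A χ) := by
    rintro g _ ⟨hv, χ, rfl⟩
    refine ⟨fun h => hv ?_, _, hΓ.smul_jointEigenspace g A χ⟩
    rw [smul_eq_iff_eq_inv_smul] at h
    rw [h, smul_submodule_def, Submodule.map_bot]
  let a : OrthDecomp (p ^ k) :=
    { classes := {v | v ≠ ⊥ ∧ ∃ χ : A → ℂ, v = jointEigenspace A χ}
      ne_bot := fun v hv => hv.1
      ne_top := by
        rintro _ ⟨hv, χ, rfl⟩ htop
        refine hne ((hiso χ hv).symm.trans (top_le_iff.1 fun g _ => ?_))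
        rw [htop]
        exact smul_eq_self_of_le le_top
      orthogonal := by
        rintro _ ⟨hv, χ, rfl⟩ _ ⟨hw, ψ, rfl⟩ hvw
        exact isOrtho_jointEigenspace fun h => hvw (by rw [h])
      sSup_eq_top := by
        -- The eigenspaces span by irreducibility: their sum is invariant, and one of them is
        -- nonzero.
        obtain ⟨χ, hχ⟩ := exists_jointEigenspace_ne_bot hA
        refine (hΓ.eq_bot_or_eq_top fun g => ?_).resolve_left fun h => hχ (le_bot_iff.1 (h ▸
          le_sSup ⟨hχ, χ, rfl⟩))
        rw [smul_submodule_def, sSup_eq_iSup, Submodule.map_iSup]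
        refine iSup_le fun v => ?_
        rw [Submodule.map_iSup]
        exact iSup_le fun hv => le_biSup (fun v => v) (hsmul g v hv) }
  refine ⟨⟨a, fun g hg => OrthDecomp.ext (Set.Subset.antisymm ?_ fun v hv => ?_)⟩, ?_⟩
  · rintro _ ⟨v, hv, rfl⟩
    exact hsmul ⟨g, hg⟩ v hv
  · exact ⟨g⁻¹ • v, hsmul (⟨g, hg⟩⁻¹ : Γ) v hv, smul_inv_smul g v⟩
  · rintro _ ⟨hv, χ, rfl⟩
    exact hiso χ hv

/-- The isotropy group of the components of a fixed decomposition. -/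
theorem exists_classIsotropy (a : FixedDecomp Γ) :
    ∃ J : SymplecticTits Γ, ∀ v ∈ a.1.classes, isotropy Γ v = J.1 := by
  have := nontrivial_space p k
  obtain ⟨v, hv⟩ := a.1.exists_mem_classes
  exact ⟨⟨isotropy Γ v, hΓ.isCoisotropic_isotropy a hv, hΓ.isotropy_ne_top a hv⟩,
    fun w hw => hΓ.isotropy_eq a hw hv⟩

/-- The isomorphism between fixed decompositions and proper coisotropic subgroups. -/
theorem exists_orderIso : ∃ Φ : FixedDecomp Γ ≃o SymplecticTits Γ,
    ∀ a : FixedDecomp Γ, ∀ v ∈ a.1.classes, isotropy Γ v = (Φ a).1 := by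
  have := nontrivial_space p k
  choose f hf using hΓ.exists_classIsotropy
  have hle : ∀ a b, f a ≤ f b ↔ a ≤ b := by
    intro a b
    obtain ⟨v, hv⟩ := a.1.exists_mem_classes
    obtain ⟨w, hw⟩ := b.1.exists_mem_classes
    rw [hΓ.le_iff_isotropy_le a b hv hw, hf a v hv, hf b w hw]
    rfl
  have hsurj : Function.Surjective f := by
    rintro ⟨H, hH, hne⟩
    obtain ⟨a, ha⟩ := hΓ.exists_isotropy_eq hH hne
    obtain ⟨v, hv⟩ := a.1.exists_mem_classes
    exact ⟨a, Subtype.ext ((hf a v hv).symm.trans (ha v hv))⟩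
  exact ⟨RelIso.ofSurjective (OrderEmbedding.ofMapLEIff f hle) hsurj, hf⟩

theorem finite_symplecticTits : Finite (SymplecticTits Γ) := by
  have := hΓ.finite_quotient
  refine Finite.of_injective (fun J : SymplecticTits Γ =>
    J.1.map (QuotientGroup.mk' (circleIn Γ))) ?_
  rintro ⟨_, ⟨W, hW, rfl⟩, hne⟩ ⟨_, ⟨W', hW', rfl⟩, hne'⟩ h
  have hs := QuotientGroup.mk'_surjective (circleIn Γ)
  simp only [Subgroup.map_comap_eq_self_of_surjective hs] at h
  subst h
  rfl

end IsGammaSubgroup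

/-! ### Assembly of the algebra and the topology -/

theorem theorem1p1 (p k : ℕ) [Fact p.Prime] (Γ : Subgroup (U (p ^ k)))
    (hΓ : IsGammaSubgroup p k Γ) :
    ∃ Φ : FixedDecomp Γ ≃o SymplecticTits Γ,
      -- `Φ` sends a decomposition to its uniform isotropy group
      (∀ a : FixedDecomp Γ, ∀ v ∈ a.1.classes, isotropy Γ v = (Φ a).1) ∧
      -- the inverse sends `H` to the decomposition into `H`-isotypical summands
      (∀ H : SymplecticTits Γ, (Φ.symm H).1.classes = isotypicalSummands H.1) ∧
      -- `Φ` is an isomorphism of topological posets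
      IsHomeomorph Φ ∧
      IsHomeomorph (Mor.map (Φ : FixedDecomp Γ →o SymplecticTits Γ)) ∧
      -- of their nerves, as simplicial spaces
      (∀ m, IsHomeomorph (Nerve.map (Φ : FixedDecomp Γ →o SymplecticTits Γ) m)) ∧
      -- and of their geometric realizations
      IsHomeomorph (Realization.map (Φ : FixedDecomp Γ →o SymplecticTits Γ)) ∧
      -- and it induces a homeomorphism from the fixed points of the realization of `𝓛`
      ∃ Ψ : realizationFixedPoints Γ ≃ₜ Realization (SymplecticTits Γ),
        ∀ y, (Ψ.symm y : Realization (OrthDecomp (p ^ k))) =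
          Realization.map (FixedDecomp.incl Γ)
            (Realization.map (Φ.symm : SymplecticTits Γ →o FixedDecomp Γ) y) := by
  have := IsGammaSubgroup.nontrivial_space p k
  obtain ⟨Φ, hΦ⟩ := hΓ.exists_orderIso
  have := hΓ.finite_symplecticTits
  -- The algebraic bijection supplies the finiteness that makes objects and morphisms of the fixed
  -- poset discrete; every homeomorphism claim rests on this.
  have : Finite (FixedDecomp Γ) := Finite.of_equiv _ Φ.symm.toEquiv
  have := FixedDecomp.discreteTopology Γ
  have := FixedDecomp.discreteTopology_mor Γ
  have : DiscreteTopology (SymplecticTits Γ) := ⟨rfl⟩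
  have : DiscreteTopology (Mor (SymplecticTits Γ)) := ⟨rfl⟩
  have h : IsHomeomorph Φ := Φ.toEquiv.toHomeomorphOfDiscrete.isHomeomorph
  have h' : IsHomeomorph (Mor.map (Φ : FixedDecomp Γ →o SymplecticTits Γ)) :=
    Φ.morEquiv.toHomeomorphOfDiscrete.isHomeomorph
  refine ⟨Φ, hΦ, fun H => ?_, h, h', Φ.isHomeomorph_nerve_map h h',
    (Φ.realizationHomeomorph h h').isHomeomorph,
    (FixedDecomp.realizationHomeomorph Γ).symm.trans (Φ.realizationHomeomorph h h'), fun y => rfl⟩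
  obtain ⟨v, hv⟩ := (Φ.symm H).1.exists_mem_classes
  rw [← hΓ.isotypicalSummands_isotropy _ hv, hΦ _ v hv, Φ.apply_symm_apply]
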